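/- **Definitions.** For a finite family $(\eta(x))_{x\in F}$ of $\{0,1\}$-valued random variables on a common probability space, let $$Q_F(z)=E\prod_{x\in F}z_x^{\eta(x)}$$ be its generating polynomial. The finite family is *strong Rayleigh* if $$\frac{\partial Q_F}{\partial z_i}(z)\,\frac{\partial Q_F}{\partial z_j}(z)\ \ge\ Q_F(z)\,\frac{\partial^2 Q_F}{\partial z_i\,\partial z_j}(z)\qquad\text{for all } z\in\mathbb R^F \text{ and all distinct } i,j\in F.$$ A countable family is strong Rayleigh if each of its finite subfamilies is (for a finite family this is the same notion). **Proposition 2.2.** For each $n\in\mathbb N$ let $\{\eta_n(x)\}_{x\in I_n}$ be a strong Rayleigh family of Bernoulli (that is, $\{0,1\}$-valued) random variables on a probability space, indexed by a finite or countably infinite set $I_n$; the probability space and the index set may depend on $n$. Assume that $\sum_{x}E\eta_n(x)<\infty$ for all sufficiently large $n$ (this is automatic if the $I_n$ are finite). (a) Let $\lambda\in[0,\infty)$. If $$\lim_{n\to\infty}\sum_xE\eta_n(x)=\lambda,\qquad \lim_{n\to\infty}\sum_x[E\eta_n(x)]^2=0,\qquad \lim_{n\to\infty}\sum_{x\ne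 y}\operatorname{Cov}(\eta_n(x),\eta_n(y))=0,$$ then $\sum_x\eta_n(x)$ converges in distribution to the Poisson distribution with parameter $\lambda$ (the point mass at $0$ if $\lambda=0$) as $n\to\infty$. (b) If $\lim_{n\to\infty}\operatorname{Var}\big(\sum_x\eta_n(x)\big)=\infty$, then $$\frac{\sum_x\eta_n(x)-E\sum_x\eta_n(x)}{\sqrt{\operatorname{Var}\big(\sum_x\eta_n(x)\big)}}$$ converges in distribution to the standard normal distribution $N(0,1)$ as $n\to\infty$. -/

import Mathlib

open MeasureTheory ProbabilityTheory Filter Topology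
open scoped NNReal

/-- The generating polynomial `E ∏_{x ∈ F} z_x ^ η(x)` of the finite subfamily `(η x)_{x ∈ F}` of a
family of `{0,1}`-valued random variables: the sum, over all `S ⊆ F`, of the probability that
`{x ∈ F : η x = 1} = S` and the other `η x`, `x ∈ F`, vanish, times the monomial `∏_{x ∈ S} z_x`. -/
noncomputable def generatingPolynomial {Ω ι : Type*} [MeasurableSpace Ω] (P : Measure Ω)
    (η : ι → Ω → ℝ) (F : Finset ι) : MvPolynomial ι ℝ :=
  ∑ S ∈ F.powerset,
    MvPolynomial.C (P.real {ω | ∀ x ∈ F, η x ω = (S : Set ι).indicator 1 x}) *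
      ∏ x ∈ S, MvPolynomial.X x

/-- The strong Rayleigh inequalities for the joint law of the finite subfamily `(η x)_{x ∈ F}`:
`∂_i Q(z) ∂_j Q(z) ≥ Q(z) ∂_i ∂_j Q(z)` for all real `z` and all distinct `i, j ∈ F`, where `Q` is
the generating polynomial. -/
def StrongRayleighOn {Ω ι : Type*} [MeasurableSpace Ω] (P : Measure Ω)
    (η : ι → Ω → ℝ) (F : Finset ι) : Prop :=
  ∀ z : ι → ℝ, ∀ i ∈ F, ∀ j ∈ F, i ≠ j →
    MvPolynomial.eval z (generatingPolynomial P η F) *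
        MvPolynomial.eval z
          (MvPolynomial.pderiv i (MvPolynomial.pderiv j (generatingPolynomial P η F))) ≤
      MvPolynomial.eval z (MvPolynomial.pderiv i (generatingPolynomial P η F)) *
        MvPolynomial.eval z (MvPolynomial.pderiv j (generatingPolynomial P η F))

/-- A strong Rayleigh family of Bernoulli random variables: `{0,1}`-valued (almost surely) random
variables on a common probability space such that the joint law of every finite subfamily is strong
Rayleigh. If the index type is finite, it is enough that the joint law of the whole family is strong
Rayleigh, since setting `z_x = 1` in the generating polynomial gives that of the subfamily without
`η x`; see `strongRayleighFamily_iff_of_fintype`. -/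
structure StrongRayleighFamily {Ω ι : Type*} [MeasurableSpace Ω] (P : Measure Ω)
    (η : ι → Ω → ℝ) : Prop where
  aemeasurable : ∀ x, AEMeasurable (η x) P
  bernoulli : ∀ x, ∀ᵐ ω ∂P, η x ω = 0 ∨ η x ω = 1
  strongRayleigh : ∀ F : Finset ι, StrongRayleighOn P η F

/-- Setting `z_a = 1` in the generating polynomial of a family gives the generating polynomial of
the family without `η a`. -/
theorem generatingPolynomial_insert {Ω ι : Type*} [MeasurableSpace Ω] [DecidableEq ι]
    {P : Measure Ω} [IsProbabilityMeasure P] {η : ι → Ω → ℝ}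
    (hm : ∀ x, AEMeasurable (η x) P) (hb : ∀ x, ∀ᵐ ω ∂P, η x ω = 0 ∨ η x ω = 1)
    {F : Finset ι} {a : ι} (ha : a ∉ F) :
    MvPolynomial.aeval (Function.update MvPolynomial.X a 1 : ι → MvPolynomial ι ℝ)
      (generatingPolynomial P η (insert a F)) = generatingPolynomial P η F := by
  have hprod : ∀ S ∈ F.powerset,
      (∏ x ∈ S, (Function.update MvPolynomial.X a 1 : ι → MvPolynomial ι ℝ) x) =
        ∏ x ∈ S, MvPolynomial.X x := by
    intro S hS
    refine Finset.prod_congr rfl fun x hx ↦ ?_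
    have : x ≠ a := fun h ↦ ha (h ▸ Finset.mem_powerset.1 hS hx)
    simp [this]
  have hnull : ∀ (G S : Finset ι),
      NullMeasurableSet {ω | ∀ x ∈ G, η x ω = (S : Set ι).indicator 1 x} P := by
    intro G S
    have : {ω | ∀ x ∈ G, η x ω = (S : Set ι).indicator 1 x} =
        ⋂ x ∈ G, (η x) ⁻¹' {(S : Set ι).indicator 1 x} := by
      ext ω; simp
    rw [this]
    exact Finset.nullMeasurableSet_biInter G fun x _ ↦
      (hm x).nullMeasurableSet_preimage (measurableSet_singleton _)
  unfold generatingPolynomial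
  rw [Finset.sum_powerset_insert ha, map_add, map_sum, map_sum, ← Finset.sum_add_distrib]
  refine Finset.sum_congr rfl fun S hS ↦ ?_
  have haS : a ∉ S := fun h ↦ ha (Finset.mem_powerset.1 hS h)
  have key : P.real {ω | ∀ x ∈ F, η x ω = (S : Set ι).indicator 1 x} =
      P.real {ω | ∀ x ∈ insert a F, η x ω = (S : Set ι).indicator 1 x} +
      P.real {ω | ∀ x ∈ insert a F, η x ω = ((insert a S : Finset ι) : Set ι).indicator 1 x} := by
    rw [← measureReal_union₀ (hnull _ _)]
    · apply measureReal_congr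
      filter_upwards [hb a] with ω hω
      apply propext
      have hE : (∀ x ∈ F, η x ω = ((insert a S : Finset ι) : Set ι).indicator 1 x) ↔
          ∀ x ∈ F, η x ω = (S : Set ι).indicator 1 x := by
        refine forall₂_congr fun x hx ↦ ?_
        have : x ≠ a := fun h ↦ ha (h ▸ hx)
        simp [Set.indicator_apply, this]
      change (∀ x ∈ F, _) ↔ ((∀ x ∈ insert a F, _) ∨ (∀ x ∈ insert a F, _))
      rw [Finset.forall_mem_insert, Finset.forall_mem_insert, hE, ← or_and_right]
      have h' : η a ω = (S : Set ι).indicator 1 a ∨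
          η a ω = ((insert a S : Finset ι) : Set ι).indicator 1 a := by
        simpa [Set.indicator_apply, haS] using hω
      exact (and_iff_right h').symm
    · refine Disjoint.aedisjoint (Set.disjoint_left.2 fun ω h1 h2 ↦ ?_)
      have e1 := h1 a (Finset.mem_insert_self a F)
      have e2 := h2 a (Finset.mem_insert_self a F)
      rw [e1] at e2
      simp [haS] at e2
  rw [key, map_mul, map_mul, map_prod, map_prod, MvPolynomial.C_add, Finset.prod_insert haS]
  simp only [MvPolynomial.aeval_X, MvPolynomial.algHom_C, Function.update_self, one_mul,
    hprod S hS, MvPolynomial.algebraMap_eq]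
  ring

/-- The strong Rayleigh inequalities pass to subfamilies. -/
theorem StrongRayleighOn.subset {Ω ι : Type*} [MeasurableSpace Ω]
    {P : Measure Ω} [IsProbabilityMeasure P] {η : ι → Ω → ℝ}
    (hm : ∀ x, AEMeasurable (η x) P) (hb : ∀ x, ∀ᵐ ω ∂P, η x ω = 0 ∨ η x ω = 1)
    {F G : Finset ι} (hFG : F ⊆ G) (hG : StrongRayleighOn P η G) : StrongRayleighOn P η F := by
  classical
  have step : ∀ (F : Finset ι) (a : ι), a ∉ F → StrongRayleighOn P η (insert a F) →
      StrongRayleighOn P η F := by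
    intro F a ha h z i hi j hj hij
    have hd : ∀ k ∈ F, ∀ p : MvPolynomial ι ℝ,
        MvPolynomial.pderiv k (MvPolynomial.aeval
          (Function.update MvPolynomial.X a 1 : ι → MvPolynomial ι ℝ) p) =
        MvPolynomial.aeval (Function.update MvPolynomial.X a 1 : ι → MvPolynomial ι ℝ)
          (MvPolynomial.pderiv k p) := by
      intro k hk p
      have hka : k ≠ a := fun h ↦ ha (h ▸ hk)
      induction p using MvPolynomial.induction_on with
      | C r => simp [MvPolynomial.algHom_C]
      | add p q hp hq => simp only [map_add, hp, hq]
      | mul_X p x hp =>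
        rw [map_mul, Derivation.leibniz, Derivation.leibniz, hp, MvPolynomial.aeval_X]
        by_cases hx : x = a
        · subst hx
          simp [MvPolynomial.pderiv_X_of_ne hka.symm]
        · by_cases hxk : x = k
          · subst hxk
            simp [hx]
          · simp [hx, MvPolynomial.pderiv_X_of_ne hxk]
    have he : ∀ p : MvPolynomial ι ℝ, MvPolynomial.eval z (MvPolynomial.aeval
        (Function.update MvPolynomial.X a 1 : ι → MvPolynomial ι ℝ) p) =
        MvPolynomial.eval (Function.update z a 1) p := by
      intro p
      induction p using MvPolynomial.induction_on with
      | C r => simp [MvPolynomial.algHom_C]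
      | add p q hp hq => simp only [map_add, hp, hq]
      | mul_X p x hp =>
        rw [map_mul, map_mul, map_mul, hp, MvPolynomial.aeval_X, MvPolynomial.eval_X]
        by_cases hx : x = a
        · subst hx; simp
        · simp [hx]
    have := h (Function.update z a 1) i (Finset.mem_insert_of_mem hi) j
      (Finset.mem_insert_of_mem hj) hij
    rw [← generatingPolynomial_insert hm hb ha, hd j hj, hd i hi, hd i hi, he, he, he, he]
    exact this
  have main : ∀ D : Finset ι, StrongRayleighOn P η (D ∪ F) → StrongRayleighOn P η F := by
    intro D
    induction D using Finset.induction_on with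
    | empty => simp
    | insert a D _ ih =>
      intro h
      rw [Finset.insert_union] at h
      by_cases hmem : a ∈ D ∪ F
      · exact ih (by rwa [Finset.insert_eq_of_mem hmem] at h)
      · exact ih (step _ a hmem h)
  exact main G (by rwa [Finset.union_eq_left.2 hFG])

/-- For a finite family, being strong Rayleigh is a condition on the joint law of the whole
family only. -/
theorem strongRayleighFamily_iff_of_fintype {Ω ι : Type*} [MeasurableSpace Ω] [Fintype ι]
    {P : Measure Ω} [IsProbabilityMeasure P] {η : ι → Ω → ℝ}
    (hm : ∀ x, AEMeasurable (η x) P) (hb : ∀ x, ∀ᵐ ω ∂P, η x ω = 0 ∨ η x ω = 1) :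
    StrongRayleighFamily P η ↔ StrongRayleighOn P η Finset.univ :=
  ⟨fun h ↦ h.strongRayleigh _,
    fun h ↦ ⟨hm, hb, fun F ↦ h.subset hm hb (Finset.subset_univ F)⟩⟩

/-! The key fact is that a nonzero multi-affine real polynomial satisfying the Rayleigh inequalities
is stable: it has no zero with all variables in the open upper half-plane
(`IsRayleigh.multiaffine_ne_zero`). Put all variables equal to w in the generating polynomial of a
finite subfamily F with count N. Then E w^N has no zero in the upper half-plane, hence by
conjugation only real zeros, and none is positive because the coefficients are probabilities. It
therefore splits into factors (1 - p) + pX with p in [0, 1]: N has the law of a sum of independent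
Bernoulli variables (`StrongRayleighFamily.exists_bernoulli`).

Stability goes by induction on the number of variables. Write the polynomial as A + z_n B. For real
c, A + cB is again Rayleigh, so it is stable by induction and A/B takes no real value on the upper
half-planes; by connectedness Im(A/B) has one sign along a line t ↦ x + ty with y > 0. The Rayleigh
inequalities make the Wronskian in t nonnegative on the real axis, which forces the sign to be
positive. So z_n = -A/B is impossible when Im z_n > 0.

Both limit theorems become explicit estimates of characteristic functions. The mean of N is Σp and
its variance Σp - Σp². The Poisson error is at most 12 Σp², and expanding the variance in
covariances gives Σp² = Σ(Eη)² - ΣCov, which the hypotheses of (a) send to 0. With σ² = Var N, the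
Gaussian error of the standardized count at u is at most 4|u|³/σ + u⁴/σ². Countable families follow
by letting F exhaust the index set. -/

/-- The multi-affine polynomial with coefficients `a S`, `S ⊆ F`, evaluated at a point with
coordinates in an `ℝ`-algebra. -/
noncomputable def multiaffine {ι K : Type*} [CommRing K] [Algebra ℝ K] (a : Finset ι → ℝ)
    (F : Finset ι) (z : ι → K) : K :=
  ∑ S ∈ F.powerset, algebraMap ℝ K (a S) * ∏ x ∈ S, z x

/-! ### Multi-affine polynomials and the Rayleigh inequalities. -/

section multiaffine

variable {ι K L : Type*} [CommRing K] [Algebra ℝ K] [CommRing L] [Algebra ℝ L]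

theorem map_multiaffine (φ : K →ₐ[ℝ] L) (a : Finset ι → ℝ) (F : Finset ι) (z : ι → K) :
    φ (multiaffine a F z) = multiaffine a F (fun x ↦ φ (z x)) := by
  simp [multiaffine, map_sum, map_prod]

theorem multiaffine_congr {a b : Finset ι → ℝ} {F : Finset ι} {z w : ι → K}
    (hab : ∀ S ⊆ F, a S = b S) (hzw : ∀ x ∈ F, z x = w x) :
    multiaffine a F z = multiaffine b F w := by
  refine Finset.sum_congr rfl fun S hS ↦ ?_
  have hS := Finset.mem_powerset.1 hS
  rw [hab S hS, Finset.prod_congr rfl fun x hx ↦ hzw x (hS hx)]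

theorem multiaffine_add_smul (a b : Finset ι → ℝ) (c : ℝ) (F : Finset ι) (z : ι → K) :
    multiaffine (fun S ↦ a S + c * b S) F z =
      multiaffine a F z + algebraMap ℝ K c * multiaffine b F z := by
  simp only [multiaffine, map_add, map_mul, add_mul, Finset.sum_add_distrib, Finset.mul_sum,
    mul_assoc]

theorem multiaffine_eq_zero {a : Finset ι → ℝ} {F : Finset ι} (ha : ∀ S ⊆ F, a S = 0)
    (z : ι → K) : multiaffine a F z = 0 :=
  Finset.sum_eq_zero fun S hS ↦ by rw [ha S (Finset.mem_powerset.1 hS)]; simp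

variable [DecidableEq ι]

theorem multiaffine_insert (a : Finset ι → ℝ) {F : Finset ι} {i : ι} (hi : i ∉ F) (z : ι → K) :
    multiaffine a (insert i F) z =
      multiaffine a F z + z i * multiaffine (fun S ↦ a (insert i S)) F z := by
  simp only [multiaffine]
  rw [Finset.sum_powerset_insert hi, Finset.mul_sum]
  congr 1
  refine Finset.sum_congr rfl fun S hS ↦ ?_
  rw [Finset.prod_insert fun h ↦ hi (Finset.mem_powerset.1 hS h)]
  ring

theorem multiaffine_erase (a : Finset ι → ℝ) {F : Finset ι} {i : ι} (hi : i ∈ F) (z : ι → K) :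
    multiaffine a F z = multiaffine a (F.erase i) z +
      z i * multiaffine (fun S ↦ a (insert i S)) (F.erase i) z := by
  rw [← multiaffine_insert a (Finset.notMem_erase i F), Finset.insert_erase hi]

-- Chain rule: shifting the coefficients by `insert i` is the partial derivative in the variable i.
-- Along a line, this writes a Wronskian as a sum over i of Rayleigh differences.
open Polynomial in
theorem derivative_multiaffine (a : Finset ι → ℝ) (F : Finset ι) (z : ι → ℝ[X]) :
    derivative (multiaffine a F z) =
      ∑ i ∈ F, derivative (z i) * multiaffine (fun S ↦ a (insert i S)) (F.erase i) z := by
  induction F using Finset.induction_on generalizing a with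
  | empty => simp [multiaffine]
  | insert n F hn ih =>
    rw [multiaffine_insert a hn, derivative_add, derivative_mul, ih, ih, Finset.sum_insert hn,
      Finset.erase_insert hn, Finset.mul_sum]
    have : ∀ i ∈ F, derivative (z i) *
        multiaffine (fun S ↦ a (insert i S)) ((insert n F).erase i) z =
        derivative (z i) * multiaffine (fun S ↦ a (insert i S)) (F.erase i) z +
        z n * (derivative (z i) * multiaffine (fun S ↦ a (insert n (insert i S))) (F.erase i) z) := by
      intro i hi
      have hni : n ≠ i := fun h ↦ hn (h ▸ hi)
      rw [Finset.erase_insert_of_ne hni,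
        multiaffine_insert _ (fun h ↦ hn (Finset.mem_of_mem_erase h))]
      simp only [Finset.insert_comm i n]
      ring
    rw [Finset.sum_congr rfl this, Finset.sum_add_distrib]
    ring

/-- The Rayleigh inequalities for the multi-affine polynomial with coefficients `a S`, `S ⊆ F`. -/
def IsRayleigh (a : Finset ι → ℝ) (F : Finset ι) : Prop :=
  ∀ z : ι → ℝ, ∀ i ∈ F, ∀ j ∈ F, i ≠ j →
    multiaffine a ((F.erase i).erase j) z *
        multiaffine (fun S ↦ a (insert i (insert j S))) ((F.erase i).erase j) z ≤
      multiaffine (fun S ↦ a (insert i S)) ((F.erase i).erase j) z *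
        multiaffine (fun S ↦ a (insert j S)) ((F.erase i).erase j) z

/-- This is the specialization z_n = c of the inequalities for the larger set. -/
theorem IsRayleigh.add_smul {a : Finset ι → ℝ} {F : Finset ι} {n : ι} (hn : n ∉ F)
    (h : IsRayleigh a (insert n F)) (c : ℝ) :
    IsRayleigh (fun S ↦ a S + c * a (insert n S)) F := by
  intro z i hi j hj hij
  have hni : n ≠ i := fun h ↦ hn (h ▸ hi)
  have hnj : n ≠ j := fun h ↦ hn (h ▸ hj)
  have hG : n ∉ (F.erase i).erase j := by simp [hn]
  have key : ∀ b : Finset ι → ℝ,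
      multiaffine b (insert n ((F.erase i).erase j)) (Function.update z n c) =
      multiaffine (fun S ↦ b S + c * b (insert n S)) ((F.erase i).erase j) z := by
    intro b
    have hz : ∀ x ∈ (F.erase i).erase j, Function.update z n c x = z x := fun x hx ↦
      Function.update_of_ne (ne_of_mem_of_not_mem hx hG) _ _
    rw [multiaffine_insert _ hG, multiaffine_add_smul, Function.update_self,
      multiaffine_congr (fun _ _ ↦ rfl) hz, multiaffine_congr (fun _ _ ↦ rfl) hz]
    rfl
  have := h (Function.update z n c) i (Finset.mem_insert_of_mem hi) j
    (Finset.mem_insert_of_mem hj) hij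
  rw [Finset.erase_insert_of_ne hni, Finset.erase_insert_of_ne hnj, key, key, key, key] at this
  simp only [Finset.insert_comm n j, Finset.insert_comm n i]
  simpa only [Finset.insert_comm n i, Finset.insert_comm n j] using this

theorem quadratic_coeff_nonneg {A B C : ℝ} (h : ∀ x : ℝ, 0 ≤ A + B * x + C * x ^ 2) : 0 ≤ C := by
  by_contra! hC
  -- At this x ≥ 1 one has B + Cx < -|A| - 1, so A + x(B + Cx) is negative.
  have h1 := h ((|A| + |B| + 1) / (-C) + 1)
  set x := (|A| + |B| + 1) / (-C) + 1 with hx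
  have hx1 : 1 ≤ x := by
    have : 0 ≤ (|A| + |B| + 1) / (-C) := by apply div_nonneg <;> [positivity; linarith]
    linarith
  have hCx : C * x = -(|A| + |B| + 1) + C := by
    rw [hx]; field_simp [hC.ne]
  have : A + B * x + C * x ^ 2 = A + x * (B + C * x) := by ring
  rw [this, hCx] at h1
  nlinarith [le_abs_self A, le_abs_self B, abs_nonneg A, abs_nonneg B]

theorem mul_le_mul_of_forall_add_mul_le {p₀ p₁ q₀ q₁ r₀ r₁ s₀ s₁ : ℝ}
    (h : ∀ x : ℝ, (p₀ + x * p₁) * (q₀ + x * q₁) ≤ (r₀ + x * r₁) * (s₀ + x * s₁)) :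
    p₁ * q₁ ≤ r₁ * s₁ := by
  rw [← sub_nonneg]
  refine quadratic_coeff_nonneg (A := r₀ * s₀ - p₀ * q₀)
    (B := r₀ * s₁ + r₁ * s₀ - p₀ * q₁ - p₁ * q₀) fun x ↦ ?_
  linear_combination h x

/-- The differentiated polynomial is the leading part of A + cB as c → ∞: the inequality for every c
is quadratic in c, and its top coefficient is the claim. -/
theorem IsRayleigh.deriv {a : Finset ι → ℝ} {F : Finset ι} {n : ι} (hn : n ∉ F)
    (h : IsRayleigh a (insert n F)) : IsRayleigh (fun S ↦ a (insert n S)) F := by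
  intro z i hi j hj hij
  have key := fun c ↦ h.add_smul hn c z i hi j hj hij
  simp only [multiaffine_add_smul, Algebra.algebraMap_self, RingHom.id_apply] at key
  exact mul_le_mul_of_forall_add_mul_le key

end multiaffine

/-! ### Rational functions on the upper half-plane. -/

section univariate

open Polynomial

/-- If all the polynomials `p + x q`, `x` real, and `q` have no zeros in the upper half-plane, and
the Wronskian `p' q - p q'` is nonnegative on the real line, then `p / q` maps the upper half-plane
to itself. -/
theorem im_div_pos_of_wronskian_nonneg {p q : ℝ[X]}
    (hq : ∀ t : ℂ, 0 < t.im → aeval t q ≠ 0)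
    (hpq : ∀ x : ℝ, ∀ t : ℂ, 0 < t.im → aeval t p + x * aeval t q ≠ 0)
    (hW : ∀ t : ℝ, 0 ≤ (derivative p * q - p * derivative q).eval t)
    {t : ℂ} (ht : 0 < t.im) : 0 < (aeval t p / aeval t q : ℂ).im := by
  set g : ℂ → ℂ := fun t ↦ aeval t p / aeval t q with hg
  -- A real value r of g = p/q would be a zero of p - rq.
  have hne : ∀ s : ℂ, 0 < s.im → (g s).im ≠ 0 := by
    intro s hs h0
    refine hpq (-(g s).re) s hs ?_
    have : g s = ((g s).re : ℂ) := Complex.ext (by simp) (by simp [h0])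
    have h2 : aeval s p = g s * aeval s q := by
      rw [hg]; field_simp [hq s hs]
    rw [h2]; push_cast; rw [← this]; ring
  have hderiv : ∀ s : ℂ, aeval s q ≠ 0 →
      HasDerivAt g (aeval s (derivative p * q - p * derivative q) / (aeval s q) ^ 2) s := by
    intro s hs
    convert! (p.hasDerivAt_aeval s).div (q.hasDerivAt_aeval s) hs using 1
    simp
  have hconv : Convex ℝ {s : ℂ | 0 < s.im} := convex_halfSpace_im_gt 0
  have hcont : ContinuousOn (fun s ↦ (g s).im) {s : ℂ | 0 < s.im} := fun s hs ↦
    (Complex.continuous_im.continuousAt.comp (hderiv s (hq s hs)).continuousAt).continuousWithinAt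
  by_contra hneg
  have hlt : (g t).im < 0 := lt_of_le_of_ne (not_lt.1 hneg) (hne t ht)
  have hall : ∀ s : ℂ, 0 < s.im → (g s).im < 0 := by
    intro s hs
    by_contra! h
    obtain ⟨r, hr, hr0⟩ := hconv.isPreconnected.intermediate_value ht hs hcont
      (show (0 : ℝ) ∈ Set.Icc _ _ from ⟨hlt.le, h⟩)
    exact hne r hr hr0
  have hq0 : q ≠ 0 := by
    rintro rfl
    exact hq t ht (by simp)
  -- approach a real point vertically
  have hup : ∀ x : ℝ, q.eval x ≠ 0 → (derivative p * q - p * derivative q).eval x = 0 := by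
    intro x hx
    have hx' : aeval (x : ℂ) q = ((q.eval x : ℝ) : ℂ) := by
      rw [← Complex.coe_algebraMap, aeval_algebraMap_apply_eq_algebraMap_eval]
    have hxq : aeval (x : ℂ) q ≠ 0 := by rw [hx']; exact_mod_cast hx
    have hd := hderiv x hxq
    have hγ : HasDerivAt (fun e : ℝ ↦ (x : ℂ) + e * Complex.I) Complex.I 0 := by
      simpa using ((Complex.ofRealCLM.hasDerivAt (x := 0)).mul_const Complex.I).const_add (x : ℂ)
    have hcomp : HasDerivAt (fun e : ℝ ↦ g ((x : ℂ) + e * Complex.I))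
        (aeval (x : ℂ) (derivative p * q - p * derivative q) / (aeval (x : ℂ) q) ^ 2 * Complex.I)
        0 := by
      refine HasDerivAt.comp (h₂ := g) (h := fun e : ℝ ↦ (x : ℂ) + e * Complex.I) (0 : ℝ) ?_ hγ
      simpa using hd
    have him := Complex.imCLM.hasFDerivAt.comp_hasDerivAt (0 : ℝ) hcomp
    have hval : aeval (x : ℂ) (derivative p * q - p * derivative q) / (aeval (x : ℂ) q) ^ 2 =
        (((derivative p * q - p * derivative q).eval x / (q.eval x) ^ 2 : ℝ) : ℂ) := by
      rw [hx', ← Complex.coe_algebraMap, aeval_algebraMap_apply_eq_algebraMap_eval]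
      push_cast [Complex.coe_algebraMap]; rfl
    rw [hval] at him
    simp only [Complex.imCLM_apply, Complex.im_ofReal_mul, Complex.I_im, mul_one] at him
    have h0 : (g x).im = 0 := by
      have hp' : aeval (x : ℂ) p = ((p.eval x : ℝ) : ℂ) := by
        rw [← Complex.coe_algebraMap, aeval_algebraMap_apply_eq_algebraMap_eval]
      simp only [hg, hx', hp']
      rw [← Complex.ofReal_div, Complex.ofReal_im]
    -- Im g vanishes at the real point x and is negative just above it, so its upward derivative,
    -- which is g'(x) = W(x)/q(x)² for the Wronskian W, is at most 0.
    have hle : (derivative p * q - p * derivative q).eval x / (q.eval x) ^ 2 ≤ 0 := by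
      have hs := him.hasDerivWithinAt (s := Set.Ioi (0:ℝ))
      rw [hasDerivWithinAt_iff_tendsto_slope' (by simp)] at hs
      refine le_of_tendsto hs ?_
      filter_upwards [self_mem_nhdsWithin] with e he
      have he : 0 < e := he
      rw [slope_def_field]
      simp only [Function.comp, Complex.imCLM_apply, Complex.ofReal_zero, zero_mul, add_zero, h0]
      apply div_nonpos_of_nonpos_of_nonneg
      · have := hall (x + e * Complex.I) (by simpa using he)
        linarith
      · linarith
    have hpos : 0 < (q.eval x) ^ 2 := by positivity
    have := hW x
    by_contra hne0
    have hlt' := lt_of_le_of_ne this (Ne.symm hne0)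
    exact absurd (div_pos hlt' hpos) (not_lt.2 hle)
  have hinf : Set.Infinite {x : ℝ | q.eval x ≠ 0} := by
    have hfin : Set.Finite {x : ℝ | q.eval x = 0} := by
      refine (q.roots.toFinset.finite_toSet).subset fun x hx ↦ ?_
      simpa [hq0] using hx
    exact hfin.infinite_compl
  -- The Wronskian vanishes off the finitely many zeros of q, hence identically. Then g is constant,
  -- and its boundary value at a real point is real, contradicting Im g < 0.
  have hW0 : derivative p * q - p * derivative q = 0 :=
    Polynomial.eq_zero_of_infinite_isRoot _ (hinf.mono fun x hx ↦ hup x hx)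
  have hconst : ∀ s : ℂ, 0 < s.im → g s = g t := by
    intro s hs
    refine hconv.is_const_of_fderivWithin_eq_zero (𝕜 := ℂ) (f := g)
      (fun r hr ↦ (hderiv r (hq r hr)).differentiableAt.differentiableWithinAt) ?_ hs ht
    intro r hr
    have h1 := hderiv r (hq r hr)
    rw [hW0] at h1
    have h2 := h1.hasFDerivAt.hasFDerivWithinAt (s := {s : ℂ | 0 < s.im})
    rw [h2.fderivWithin ((isOpen_lt continuous_const Complex.continuous_im).uniqueDiffWithinAt hr)]
    ext; simp
  obtain ⟨x, hx⟩ := hinf.nonempty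
  have hx' : aeval (x : ℂ) q = ((q.eval x : ℝ) : ℂ) := by
    rw [← Complex.coe_algebraMap, aeval_algebraMap_apply_eq_algebraMap_eval]
  have hp' : aeval (x : ℂ) p = ((p.eval x : ℝ) : ℂ) := by
    rw [← Complex.coe_algebraMap, aeval_algebraMap_apply_eq_algebraMap_eval]
  have hxq : aeval (x : ℂ) q ≠ 0 := by rw [hx']; exact_mod_cast hx
  have h0 : (g x).im = 0 := by
    simp only [hg, hx', hp']
    rw [← Complex.ofReal_div, Complex.ofReal_im]
  have hγ : Tendsto (fun e : ℝ ↦ (x : ℂ) + e * Complex.I) (𝓝[>] 0) (𝓝 (x : ℂ)) := by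
    refine tendsto_nhdsWithin_of_tendsto_nhds ?_
    have : Continuous (fun e : ℝ ↦ (x : ℂ) + e * Complex.I) := by fun_prop
    simpa using this.tendsto 0
  have hl := (hderiv x hxq).continuousAt.tendsto.comp hγ
  have hl2 : Tendsto (g ∘ fun e : ℝ ↦ (x : ℂ) + e * Complex.I) (𝓝[>] 0) (𝓝 (g t)) := by
    refine tendsto_const_nhds.congr' ?_
    filter_upwards [self_mem_nhdsWithin] with e he
    have he : 0 < e := he
    exact (hconst _ (by simpa using he)).symm
  rw [tendsto_nhds_unique hl2 hl, h0] at hlt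
  exact lt_irrefl _ hlt

end univariate

/-! ### Rayleigh polynomials are stable. -/

section stable

open Polynomial

variable {ι : Type*} [DecidableEq ι]

/-- A nonzero multi-affine real polynomial that satisfies the Rayleigh inequalities is stable: it
does not vanish when all the variables lie in the open upper half-plane. -/
theorem IsRayleigh.multiaffine_ne_zero {F : Finset ι} {a : Finset ι → ℝ} (h : IsRayleigh a F)
    (ha : ∃ S ⊆ F, a S ≠ 0) {z : ι → ℂ} (hz : ∀ x ∈ F, 0 < (z x).im) :
    multiaffine a F z ≠ 0 := by
  induction F using Finset.induction_on generalizing a z with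
  | empty =>
    obtain ⟨S, hS, hS0⟩ := ha
    rw [Finset.subset_empty] at hS
    subst hS
    simpa [multiaffine] using hS0
  | insert n F hn ih =>
    rw [multiaffine_insert a hn]
    set b : Finset ι → ℝ := fun S ↦ a (insert n S) with hb
    have hzF : ∀ x ∈ F, 0 < (z x).im := fun x hx ↦ hz x (Finset.mem_insert_of_mem hx)
    have hzn := hz n (Finset.mem_insert_self n F)
    have hne : (∃ S ⊆ F, a S ≠ 0) ∨ ∃ S ⊆ F, b S ≠ 0 := by
      obtain ⟨S, hS, hS0⟩ := ha
      by_cases hnS : n ∈ S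
      · refine Or.inr ⟨S.erase n, Finset.subset_insert_iff.1 hS, ?_⟩
        simpa [hb, Finset.insert_erase hnS] using hS0
      · exact Or.inl ⟨S, (Finset.subset_insert_iff_of_notMem hnS).1 hS, hS0⟩
    by_cases hb0 : ∀ S ⊆ F, b S = 0
    · rw [multiaffine_eq_zero hb0, mul_zero, add_zero]
      have h0 := h.add_smul hn 0
      simp only [zero_mul, add_zero] at h0
      refine ih h0 (hne.resolve_right ?_) hzF
      rintro ⟨S, hS, hS0⟩
      exact hS0 (hb0 S hS)
    push Not at hb0
    have hbz : ∀ w : ι → ℂ, (∀ x ∈ F, 0 < (w x).im) → multiaffine b F w ≠ 0 :=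
      fun w hw ↦ ih (h.deriv hn) hb0 hw
    -- Here A = -cB, so A + cB is the zero polynomial and the induction hypothesis does not apply to
    -- it; but the whole polynomial is (z_n - c)B.
    by_cases hc : ∃ c : ℝ, ∀ S ⊆ F, a S + c * b S = 0
    · obtain ⟨c, hc⟩ := hc
      have h1 := multiaffine_eq_zero hc z
      rw [multiaffine_add_smul] at h1
      have h2 : multiaffine a F z + z n * multiaffine b F z =
          (z n - c) * multiaffine b F z := by
        have : multiaffine a F z = - (algebraMap ℝ ℂ c * multiaffine b F z) :=
          eq_neg_of_add_eq_zero_left h1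
        rw [this, Complex.coe_algebraMap]; ring
      rw [h2]
      refine mul_ne_zero (fun h0 ↦ ?_) (hbz z hzF)
      have := congrArg Complex.im h0
      simp at this
      linarith
    push Not at hc
    -- The line t ↦ Re z + t Im z has positive direction, stays in the upper half-planes for Im t >
    -- 0, and passes through z at t = I.
    set v : ι → ℝ[X] := fun x ↦ C (z x).re + C (z x).im * X with hv
    have hev : ∀ (c : Finset ι → ℝ) (t : ℂ), aeval t (multiaffine c F v) =
        multiaffine c F (fun x ↦ ((z x).re : ℂ) + (z x).im * t) := by
      intro c t
      rw [map_multiaffine]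
      simp [hv]
    have him : ∀ t : ℂ, 0 < t.im → ∀ x ∈ F, 0 < (((z x).re : ℂ) + (z x).im * t).im := by
      intro t ht x hx
      simpa using mul_pos (hzF x hx) ht
    have key := im_div_pos_of_wronskian_nonneg (p := multiaffine a F v) (q := multiaffine b F v)
      (fun t ht ↦ by rw [hev]; exact hbz _ (him t ht))
      (fun x t ht ↦ by
        rw [hev, hev]
        have := ih (h.add_smul hn x) (hc x) (him t ht)
        rwa [multiaffine_add_smul] at this)
      (fun t ↦ by
        rw [derivative_multiaffine, derivative_multiaffine, Finset.sum_mul, Finset.mul_sum,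
          ← Finset.sum_sub_distrib, eval_finsetSum]
        -- In the i-th term the parts containing the variable i cancel, leaving Im z_i times the
        -- Rayleigh difference for i and n.
        refine Finset.sum_nonneg fun i hi ↦ ?_
        have hin : i ≠ n := fun e ↦ hn (e ▸ hi)
        have hR := h (fun x ↦ (v x).eval t) i (Finset.mem_insert_of_mem hi) n
          (Finset.mem_insert_self n F) hin
        rw [Finset.erase_insert_of_ne hin.symm,
          Finset.erase_insert (fun h ↦ hn (Finset.mem_of_mem_erase h))] at hR
        have hE : ∀ c : Finset ι → ℝ, (multiaffine c (F.erase i) v).eval t =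
            multiaffine c (F.erase i) (fun x ↦ (v x).eval t) := by
          intro c
          rw [← coe_aeval_eq_eval]
          exact map_multiaffine (aeval t) c _ v
        rw [multiaffine_erase a hi, multiaffine_erase b hi]
        simp only [hb, eval_sub, eval_mul, eval_add, hE, Finset.insert_comm n i]
        have hdv : (derivative (v i)).eval t = (z i).im := by simp [hv]
        rw [hdv]
        have := mul_nonneg (hzF i hi).le (sub_nonneg.2 hR)
        linarith)
      (t := Complex.I) (by simp)
    rw [hev, hev] at key
    have hzI : (fun x ↦ ((z x).re : ℂ) + (z x).im * Complex.I) = z := by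
      ext x; exact Complex.re_add_im _
    rw [hzI] at key
    intro h0
    have h1 : z n = - (multiaffine a F z / multiaffine b F z) := by
      have := hbz z hzF
      field_simp
      linear_combination h0
    rw [h1, Complex.neg_im] at hzn
    linarith

end stable

/-! ### Real-rooted generating polynomials as Bernoulli products. -/

section factorization

open Polynomial

/-- A real polynomial without zeros in the upper half-plane and on the positive half-line, and
with value `1` at `1`, is the generating polynomial of a sum of independent Bernoulli variables. -/
theorem exists_eq_prod_bernoulli {P : ℝ[X]} (h1 : P.eval 1 = 1)
    (hpos : ∀ x : ℝ, 0 < x → P.eval x ≠ 0) (hroot : ∀ t : ℂ, 0 < t.im → aeval t P ≠ 0) :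
    ∃ s : Multiset ℝ, (∀ p ∈ s, 0 ≤ p ∧ p ≤ 1) ∧
      P = (s.map fun p ↦ C (1 - p) + C p * X).prod := by
  induction hd : P.natDegree generalizing P with
  | zero =>
    refine ⟨0, by simp, ?_⟩
    rw [eq_C_of_natDegree_eq_zero hd] at h1 ⊢
    simp at h1
    simp [h1]
  | succ d ih =>
    have hdeg : 0 < (P.map (algebraMap ℝ ℂ)).degree := by
      rw [degree_map, ← natDegree_pos_iff_degree_pos]; omega
    obtain ⟨t, ht⟩ := Complex.exists_root hdeg
    have ht : aeval t P = 0 := by rwa [IsRoot, eval_map_algebraMap] at ht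
    have htc : aeval (starRingEnd ℂ t) P = 0 := by
      have := congrArg (starRingEnd ℂ) ht
      rw [map_zero] at this
      rw [← this]
      exact (Polynomial.aeval_conj P t)
    have him : t.im = 0 := by
      rcases lt_trichotomy t.im 0 with h | h | h
      · exact absurd htc (hroot _ (by simpa using h))
      · exact h
      · exact absurd ht (hroot t h)
    obtain ⟨r, rfl⟩ : ∃ r : ℝ, t = r := ⟨t.re, Complex.ext (by simp) (by simp [him])⟩
    have hr : P.IsRoot r := by
      rw [← Complex.coe_algebraMap, aeval_algebraMap_apply_eq_algebraMap_eval] at ht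
      exact (map_eq_zero_iff _ (algebraMap ℝ ℂ).injective).1 ht
    have hr0 : r ≤ 0 := by
      by_contra! h
      exact hpos r h hr
    obtain ⟨Q, rfl⟩ := dvd_iff_isRoot.2 hr
    have h1r : (1 - r) * Q.eval 1 = 1 := by simpa using h1
    have hQ0 : Q ≠ 0 := by
      rintro rfl
      simp at h1r
    have hQd : (C (1 - r) * Q).natDegree = d := by
      rw [natDegree_C_mul (by linarith)]
      rw [natDegree_mul (X_sub_C_ne_zero r) hQ0, natDegree_X_sub_C] at hd
      omega
    -- The cofactor is rescaled to have value 1 at 1. The extracted factor is then (X - r)/(1 - r) =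
    -- (1 - p) + pX with p = 1/(1 - r), which lies in [0, 1] since r ≤ 0.
    obtain ⟨s, hs, hsQ⟩ := ih (P := C (1 - r) * Q) (by simpa using h1r)
      (fun x hx h0 ↦ hpos x hx (by
        have h2 : (1 - r) ≠ 0 := by linarith
        simp [h2] at h0
        simp [h0]))
      (fun t ht h0 ↦ hroot t ht (by
        have h2 : ((1 : ℂ) - r) ≠ 0 := by
          have : (1 - r : ℝ) ≠ 0 := by linarith
          exact_mod_cast this
        simp [h2] at h0
        simp [h0])) hQd
    refine ⟨(1 / (1 - r)) ::ₘ s, ?_, ?_⟩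
    · intro p hp
      rcases Multiset.mem_cons.1 hp with rfl | hp
      · have : 0 < 1 - r := by linarith
        exact ⟨by positivity, by rw [div_le_one this]; linarith⟩
      · exact hs p hp
    · rw [Multiset.map_cons, Multiset.prod_cons, ← hsQ]
      have h2 : (1 - r) ≠ 0 := by linarith
      have h3 : C (1 / (1 - r)) * C (1 - r) = (1 : ℝ[X]) := by
        rw [← C_mul, one_div_mul_cancel h2, C_1]
      have h4 : C (1 - 1 / (1 - r)) * C (1 - r) = (- C r : ℝ[X]) := by
        rw [← C_mul, sub_mul, one_div_mul_cancel h2, ← C_neg]; congr 1; ring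
      linear_combination (-X * Q) * h3 - Q * h4

theorem eval_one_prod_bernoulli (s : Multiset ℝ) :
    ((s.map fun p ↦ C (1 - p) + C p * X).prod).eval 1 = 1 := by
  induction s using Multiset.induction_on with
  | empty => simp
  | cons p s ih =>
    rw [Multiset.map_cons, Multiset.prod_cons, eval_mul, ih]
    simp

theorem eval_one_derivative_prod_bernoulli (s : Multiset ℝ) :
    (derivative (s.map fun p ↦ C (1 - p) + C p * X).prod).eval 1 = s.sum := by
  induction s using Multiset.induction_on with
  | empty => simp
  | cons p s ih =>
    rw [Multiset.map_cons, Multiset.prod_cons, derivative_mul, eval_add, eval_mul, eval_mul, ih,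
      eval_one_prod_bernoulli]
    simp

/-- The second factorial moment is the sum of p q over ordered pairs of distinct factors, that is
(Σp)² - Σp². -/
theorem eval_one_derivative_derivative_prod_bernoulli (s : Multiset ℝ) :
    (derivative (derivative (s.map fun p ↦ C (1 - p) + C p * X).prod)).eval 1 =
      s.sum ^ 2 - (s.map (· ^ 2)).sum := by
  induction s using Multiset.induction_on with
  | empty => simp
  | cons p s ih =>
    simp only [Multiset.map_cons, Multiset.prod_cons, derivative_mul, derivative_add,
      derivative_C, derivative_X, zero_add, zero_mul, mul_one, eval_add, eval_mul, eval_C, eval_X,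
      Multiset.sum_cons, ih, eval_one_derivative_prod_bernoulli]
    ring

end factorization

/-! ### The count of a finite subfamily as a Bernoulli sum. -/

section law

variable {Ω ι : Type*} [MeasurableSpace Ω] {P : Measure Ω} {η : ι → Ω → ℝ}

/-- The probability that `S` is the set of indices `x ∈ F` with `η x = 1`. -/
noncomputable def jointLaw (P : Measure Ω) (η : ι → Ω → ℝ) (F S : Finset ι) : ℝ :=
  P.real {ω | ∀ x ∈ F, η x ω = (S : Set ι).indicator 1 x}

theorem generatingPolynomial_eq_multiaffine (F : Finset ι) :
    generatingPolynomial P η F = multiaffine (jointLaw P η F) F MvPolynomial.X := rfl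

theorem pderiv_multiaffine_X_of_notMem [DecidableEq ι] (a : Finset ι → ℝ) {F : Finset ι} {i : ι}
    (hi : i ∉ F) :
    MvPolynomial.pderiv i (multiaffine a F (MvPolynomial.X : ι → MvPolynomial ι ℝ)) = 0 := by
  induction F using Finset.induction_on generalizing a with
  | empty => simp [multiaffine]
  | insert n F hn ih =>
    have hin : n ≠ i := fun h ↦ hi (h ▸ Finset.mem_insert_self n F)
    have hiF : i ∉ F := fun h ↦ hi (Finset.mem_insert_of_mem h)
    rw [multiaffine_insert a hn, map_add, Derivation.leibniz, ih _ hiF, ih _ hiF,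
      MvPolynomial.pderiv_X_of_ne hin]
    simp

theorem pderiv_multiaffine_X [DecidableEq ι] (a : Finset ι → ℝ) {F : Finset ι} {i : ι}
    (hi : i ∈ F) :
    MvPolynomial.pderiv i (multiaffine a F (MvPolynomial.X : ι → MvPolynomial ι ℝ)) =
      multiaffine (fun S ↦ a (insert i S)) (F.erase i) MvPolynomial.X := by
  rw [multiaffine_erase a hi, map_add, Derivation.leibniz,
    pderiv_multiaffine_X_of_notMem _ (Finset.notMem_erase i F),
    pderiv_multiaffine_X_of_notMem _ (Finset.notMem_erase i F), MvPolynomial.pderiv_X_self]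
  simp

theorem eval_multiaffine_X (a : Finset ι → ℝ) (F : Finset ι) (z : ι → ℝ) :
    MvPolynomial.eval z (multiaffine a F (MvPolynomial.X : ι → MvPolynomial ι ℝ)) =
      multiaffine a F z := by
  rw [← MvPolynomial.coe_aeval_eq_eval]
  exact (map_multiaffine (MvPolynomial.aeval z) a F _).trans (by simp)

/-- For Q = A + z_i A_i + z_j A_j + z_i z_j A_ij, all terms containing z_i or z_j cancel in ∂_iQ
∂_jQ - Q ∂_i∂_jQ, leaving A_i A_j - A A_ij. -/
theorem StrongRayleighOn.isRayleigh [DecidableEq ι] {F : Finset ι} (h : StrongRayleighOn P η F) :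
    IsRayleigh (jointLaw P η F) F := by
  intro z i hi j hj hij
  have hji : j ∈ F.erase i := Finset.mem_erase.2 ⟨hij.symm, hj⟩
  have hij' : i ∈ F.erase j := Finset.mem_erase.2 ⟨hij, hi⟩
  have := h z i hi j hj hij
  rw [generatingPolynomial_eq_multiaffine, pderiv_multiaffine_X _ hj, pderiv_multiaffine_X _ hij',
    pderiv_multiaffine_X _ hi] at this
  simp only [eval_multiaffine_X] at this
  rw [multiaffine_erase (jointLaw P η F) hi, multiaffine_erase (jointLaw P η F) hji,
    multiaffine_erase (fun S ↦ jointLaw P η F (insert i S)) hji,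
    multiaffine_erase (fun S ↦ jointLaw P η F (insert j S)) hij',
    Finset.erase_right_comm (a := j)] at this
  simp only [Finset.insert_comm j i] at this
  linear_combination this

theorem nullMeasurableSet_jointLaw (hm : ∀ x, AEMeasurable (η x) P) (F S : Finset ι) :
    NullMeasurableSet {ω | ∀ x ∈ F, η x ω = (S : Set ι).indicator 1 x} P := by
  have : {ω | ∀ x ∈ F, η x ω = (S : Set ι).indicator 1 x} =
      ⋂ x ∈ F, (η x) ⁻¹' {(S : Set ι).indicator 1 x} := by
    ext ω; simp
  rw [this]
  exact Finset.nullMeasurableSet_biInter F fun x _ ↦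
    (hm x).nullMeasurableSet_preimage (measurableSet_singleton _)

variable [IsProbabilityMeasure P]

/-- The expectation of a function of finitely many Bernoulli variables. -/
theorem integral_eq_sum_jointLaw {E : Type*} [NormedAddCommGroup E] [NormedSpace ℝ E]
    [CompleteSpace E] (hm : ∀ x, AEMeasurable (η x) P)
    (hb : ∀ x, ∀ᵐ ω ∂P, η x ω = 0 ∨ η x ω = 1) (F : Finset ι) (f : Ω → E) (h : Finset ι → E)
    (hfh : ∀ S ⊆ F, ∀ ω, (∀ x ∈ F, η x ω = (S : Set ι).indicator 1 x) → f ω = h S) :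
    ∫ ω, f ω ∂P = ∑ S ∈ F.powerset, jointLaw P η F S • h S := by
  classical
  have hae : ∀ᵐ ω ∂P, f ω = ∑ S ∈ F.powerset,
      {ω | ∀ x ∈ F, η x ω = (S : Set ι).indicator 1 x}.indicator (fun _ ↦ h S) ω := by
    have hb' : ∀ᵐ ω ∂P, ∀ x ∈ F, η x ω = 0 ∨ η x ω = 1 :=
      (Finset.eventually_all F).2 fun x _ ↦ hb x
    filter_upwards [hb'] with ω hω
    set T := F.filter fun x ↦ η x ω = 1 with hT
    have hTω : ∀ x ∈ F, η x ω = (T : Set ι).indicator 1 x := by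
      intro x hx
      rcases hω x hx with h | h <;> simp [hT, hx, h]
    rw [Finset.sum_eq_single_of_mem T (Finset.mem_powerset.2 (Finset.filter_subset _ _))]
    · rw [Set.indicator_of_mem (by exact hTω)]
      exact hfh T (Finset.filter_subset _ _) ω hTω
    · intro S hS hST
      refine Set.indicator_of_notMem (fun hSω ↦ hST ?_) _
      ext x
      by_cases hx : x ∈ F
      · have := (hSω x hx).symm.trans (hTω x hx)
        by_cases h1 : x ∈ S <;> by_cases h2 : x ∈ T <;> simp [h1, h2] at this ⊢
      · have h1 : x ∉ S := fun h ↦ hx (Finset.mem_powerset.1 hS h)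
        have h2 : x ∉ T := fun h ↦ hx (Finset.filter_subset _ _ h)
        simp [h1, h2]
  rw [integral_congr_ae hae, integral_finsetSum]
  · refine Finset.sum_congr rfl fun S _ ↦ ?_
    rw [integral_indicator₀ (nullMeasurableSet_jointLaw hm F S)]
    simp [jointLaw]
  · intro S _
    exact (integrable_const (h S)).indicator₀ (nullMeasurableSet_jointLaw hm F S)

theorem integral_sum_eq_sum_jointLaw {E : Type*} [NormedAddCommGroup E] [NormedSpace ℝ E]
    [CompleteSpace E] (hm : ∀ x, AEMeasurable (η x) P)
    (hb : ∀ x, ∀ᵐ ω ∂P, η x ω = 0 ∨ η x ω = 1) (F : Finset ι) (f : ℝ → E) :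
    ∫ ω, f (∑ x ∈ F, η x ω) ∂P = ∑ S ∈ F.powerset, jointLaw P η F S • f S.card := by
  classical
  refine integral_eq_sum_jointLaw hm hb F _ (fun S ↦ f S.card) fun S hS ω hω ↦ ?_
  rw [Finset.sum_congr rfl hω]
  congr 1
  simp only [Set.indicator_apply, Finset.mem_coe, Pi.one_apply]
  rw [← Finset.sum_filter, Finset.filter_mem_eq_inter, Finset.inter_eq_right.2 hS]
  simp

/-- The number of points of a finite strong Rayleigh family has the law of a sum of independent
Bernoulli variables. -/
theorem StrongRayleighFamily.exists_bernoulli (h : StrongRayleighFamily P η) (F : Finset ι) :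
    ∃ s : Multiset ℝ, (∀ p ∈ s, 0 ≤ p ∧ p ≤ 1) ∧
      (∀ w : ℂ, ∀ f : ℝ → ℂ, (∀ k : ℕ, f k = w ^ k) →
        ∫ ω, f (∑ x ∈ F, η x ω) ∂P = (s.map fun p : ℝ ↦ 1 + p * (w - 1)).prod) ∧
      ∫ ω, ∑ x ∈ F, η x ω ∂P = s.sum ∧
      ∫ ω, (∑ x ∈ F, η x ω) ^ 2 ∂P = s.sum + s.sum ^ 2 - (s.map (· ^ 2)).sum := by
  classical
  set a := jointLaw P η F with ha
  have ha0 : ∀ S, 0 ≤ a S := fun S ↦ measureReal_nonneg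
  have hsum : ∑ S ∈ F.powerset, a S = 1 := by
    simpa using (integral_sum_eq_sum_jointLaw h.aemeasurable h.bernoulli F fun _ ↦ (1 : ℝ)).symm
  obtain ⟨S₀, hS₀, hS₀'⟩ : ∃ S ∈ F.powerset, a S ≠ 0 :=
    Finset.exists_ne_zero_of_sum_ne_zero (by rw [hsum]; exact one_ne_zero)
  set G : Polynomial ℝ := multiaffine a F fun _ ↦ Polynomial.X with hG
  have hGsum : G = ∑ S ∈ F.powerset, Polynomial.C (a S) * Polynomial.X ^ S.card := by
    simp [hG, multiaffine]
  have hGeval : ∀ x : ℝ, G.eval x = ∑ S ∈ F.powerset, a S * x ^ S.card := by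
    intro x; simp [hGsum, Polynomial.eval_finsetSum]
  have hGaeval : ∀ w : ℂ, Polynomial.aeval w G = multiaffine a F fun _ ↦ w := by
    intro w
    rw [hG, map_multiaffine]
    simp
  obtain ⟨s, hs, hsG⟩ := exists_eq_prod_bernoulli (P := G) (by rw [hGeval]; simpa using hsum)
    (fun x hx ↦ by
      rw [hGeval]
      refine (Finset.sum_pos' (fun S _ ↦ mul_nonneg (ha0 S) (by positivity)) ⟨S₀, hS₀, ?_⟩).ne'
      exact mul_pos (lt_of_le_of_ne (ha0 S₀) hS₀'.symm) (by positivity))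
    (fun t ht ↦ by
      rw [hGaeval]
      exact (h.strongRayleigh F).isRayleigh.multiaffine_ne_zero
        ⟨S₀, Finset.mem_powerset.1 hS₀, hS₀'⟩ fun _ _ ↦ ht)
  have hmean : ∑ S ∈ F.powerset, a S * S.card = s.sum := by
    rw [← eval_one_derivative_prod_bernoulli, ← hsG, hGsum]
    simp [Polynomial.eval_finsetSum, Polynomial.derivative_X_pow]
  have hfact : ∑ S ∈ F.powerset, a S * (S.card * (S.card - 1)) =
      s.sum ^ 2 - (s.map (· ^ 2)).sum := by
    rw [← eval_one_derivative_derivative_prod_bernoulli, ← hsG, hGsum]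
    simp only [Polynomial.derivative_sum, Polynomial.derivative_C_mul,
      Polynomial.derivative_X_pow, Polynomial.eval_finsetSum, Polynomial.eval_mul,
      Polynomial.eval_C, Polynomial.eval_pow, Polynomial.eval_X, one_pow, mul_one]
    refine Finset.sum_congr rfl fun S _ ↦ ?_
    -- Differentiation produces the truncated `S.card - 1`, so the empty set is treated apart.
    rcases Nat.eq_zero_or_pos S.card with h0 | h0
    · simp [h0]
    · rw [Nat.cast_sub h0]; simp
  refine ⟨s, hs, ?_, ?_, ?_⟩
  -- Only the values of `f` at naturals matter, since the count is almost surely a natural number.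
  · intro w f hf
    rw [integral_sum_eq_sum_jointLaw h.aemeasurable h.bernoulli]
    have h1 := hGaeval w
    rw [hsG] at h1
    simp only [multiaffine, Finset.prod_const] at h1
    simp only [hf, Complex.real_smul]
    rw [map_multiset_prod, Multiset.map_map] at h1
    rw [Complex.coe_algebraMap] at h1
    rw [← h1]
    congr 1
    refine Multiset.map_congr rfl fun p _ ↦ ?_
    simp
    ring
  · rw [integral_sum_eq_sum_jointLaw h.aemeasurable h.bernoulli F fun t ↦ t]
    simpa using hmean
  · rw [integral_sum_eq_sum_jointLaw h.aemeasurable h.bernoulli F fun t ↦ t ^ 2, add_sub_assoc,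
      ← hfact, ← hmean, ← Finset.sum_add_distrib]
    refine Finset.sum_congr rfl fun S _ ↦ ?_
    rw [smul_eq_mul]
    ring

/-- The variables of a strong Rayleigh family are negatively correlated. -/
theorem StrongRayleighFamily.covariance_nonpos (h : StrongRayleighFamily P η) {i j : ι}
    (hij : i ≠ j) : cov[η i, η j; P] ≤ 0 := by
  classical
  have hL : ∀ k, MemLp (η k) 2 P := fun k ↦ by
    refine MemLp.of_bound (h.aemeasurable k).aestronglyMeasurable 1 ?_
    filter_upwards [h.bernoulli k] with ω hω
    rcases hω with hω | hω <;> simp [hω]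
  rw [covariance_eq_sub (hL i) (hL j)]
  -- For two variables the inequality is a_∅ a_ij ≤ a_i a_j. As the four probabilities sum to 1, the
  -- covariance equals a_∅ a_ij - a_i a_j.
  have hR := (h.strongRayleigh {i, j}).isRayleigh 0 i (by simp) j (by simp) hij
  have hE : (({i, j} : Finset ι).erase i).erase j = ∅ := by
    ext x; simp; tauto
  rw [hE] at hR
  set a := jointLaw P η {i, j} with ha
  have key : ∀ (f : Ω → ℝ) (g : Finset ι → ℝ), (∀ S : Finset ι, S ⊆ {i, j} → ∀ ω,
      (∀ x ∈ ({i, j} : Finset ι), η x ω = (S : Set ι).indicator 1 x) → f ω = g S) →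
      ∫ ω, f ω ∂P = a ∅ * g ∅ + a {i} * g {i} + a {j} * g {j} + a {i, j} * g {i, j} := by
    intro f g hfg
    rw [integral_eq_sum_jointLaw h.aemeasurable h.bernoulli {i, j} f g hfg,
      Finset.sum_powerset_insert (by simpa using hij)]
    have : ({j} : Finset ι).powerset = {∅, {j}} := by
      ext S; simp [Finset.subset_singleton_iff]
    rw [this, Finset.sum_pair (by simp), Finset.sum_pair (by simp)]
    simp only [smul_eq_mul, insert_empty_eq]
    ring
  have h1 := key (fun _ ↦ 1) (fun _ ↦ 1) (by simp)
  have h2 := key (η i) (fun S ↦ (S : Set ι).indicator 1 i) (fun S _ ω hω ↦ hω i (by simp))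
  have h3 := key (η j) (fun S ↦ (S : Set ι).indicator 1 j) (fun S _ ω hω ↦ hω j (by simp))
  have h4 := key (η i * η j)
    (fun S ↦ (S : Set ι).indicator 1 i * (S : Set ι).indicator 1 j)
    (fun S _ ω hω ↦ by rw [Pi.mul_apply, hω i (by simp), hω j (by simp)])
  simp [hij, hij.symm] at h1 h2 h3 h4
  simp [multiaffine] at hR
  have h4' : ∫ ω, (η i * η j) ω ∂P = a {i, j} := by simpa using h4
  rw [h4', h2, h3]
  linear_combination hR + a {i, j} * h1

end law

/-! ### Poisson and Gaussian estimates for Bernoulli products. -/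

section estimates

open Complex

theorem norm_multiset_prod_le_one {f : ℝ → ℂ} {s : Multiset ℝ} (hf : ∀ p ∈ s, ‖f p‖ ≤ 1) :
    ‖(s.map f).prod‖ ≤ 1 := by
  induction s using Multiset.induction_on with
  | empty => simp
  | cons p s ih =>
    rw [Multiset.map_cons, Multiset.prod_cons, norm_mul]
    exact mul_le_one₀ (hf p (Multiset.mem_cons_self p s)) (norm_nonneg _)
      (ih fun q hq ↦ hf q (Multiset.mem_cons_of_mem hq))

/-- Replacing the factors one at a time costs only the individual differences, all other factors
having modulus at most 1. -/
theorem norm_multiset_prod_sub_prod_le {f g : ℝ → ℂ} {d : ℝ → ℝ} {s : Multiset ℝ}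
    (hf : ∀ p ∈ s, ‖f p‖ ≤ 1) (hg : ∀ p ∈ s, ‖g p‖ ≤ 1) (hd : ∀ p ∈ s, ‖f p - g p‖ ≤ d p) :
    ‖(s.map f).prod - (s.map g).prod‖ ≤ (s.map d).sum := by
  induction s using Multiset.induction_on with
  | empty => simp
  | cons p s ih =>
    have hmem : ∀ q ∈ s, q ∈ p ::ₘ s := fun q hq ↦ Multiset.mem_cons_of_mem hq
    have hp := Multiset.mem_cons_self p s
    have ih' := ih (fun q hq ↦ hf q (hmem q hq)) (fun q hq ↦ hg q (hmem q hq))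
      fun q hq ↦ hd q (hmem q hq)
    have hG := norm_multiset_prod_le_one fun q hq ↦ hg q (hmem q hq)
    simp only [Multiset.map_cons, Multiset.prod_cons, Multiset.sum_cons]
    calc ‖f p * (s.map f).prod - g p * (s.map g).prod‖
        = ‖(f p - g p) * (s.map g).prod + f p * ((s.map f).prod - (s.map g).prod)‖ := by
          congr 1; ring
      _ ≤ ‖f p - g p‖ * ‖(s.map g).prod‖ + ‖f p‖ * ‖(s.map f).prod - (s.map g).prod‖ := by
          refine (norm_add_le _ _).trans ?_
          rw [norm_mul, norm_mul]
      _ ≤ d p * 1 + 1 * (s.map d).sum := by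
          have := hd p hp
          have := (norm_nonneg _).trans this
          have := hf p hp
          gcongr
      _ = d p + (s.map d).sum := by ring

/-- Taylor's bound covers small x. For ‖x‖ > 1, Re x ≤ 0 gives ‖exp x‖ ≤ 1, and each of the three
terms is at most ‖x‖². -/
theorem norm_exp_sub_one_sub_le {x : ℂ} (hx : x.re ≤ 0) : ‖exp x - 1 - x‖ ≤ 3 * ‖x‖ ^ 2 := by
  rcases le_or_gt ‖x‖ 1 with h | h
  · exact (norm_exp_sub_one_sub_id_le h).trans (by nlinarith [sq_nonneg ‖x‖])
  · have h1 : ‖exp x‖ ≤ 1 := by rw [norm_exp]; exact Real.exp_le_one_iff.2 hx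
    calc ‖exp x - 1 - x‖ ≤ ‖exp x‖ + ‖(1 : ℂ)‖ + ‖x‖ :=
          (norm_sub_le _ _).trans (by gcongr; exact norm_sub_le _ _)
      _ ≤ 3 * ‖x‖ ^ 2 := by rw [norm_one]; nlinarith

theorem norm_exp_mul_I_sub_le (x : ℝ) :
    ‖exp (x * I) - (1 + x * I - (x : ℂ) ^ 2 / 2)‖ ≤ 4 * |x| ^ 3 := by
  have hnx : ‖(x * I : ℂ)‖ = |x| := by simp
  rcases le_or_gt |x| 1 with h | h
  · have := exp_bound (x := x * I) (by rwa [hnx]) (n := 3) (by norm_num)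
    rw [hnx] at this
    have h2 : ∑ m ∈ Finset.range 3, (x * I : ℂ) ^ m / m.factorial =
        1 + x * I - (x : ℂ) ^ 2 / 2 := by
      simp [Finset.sum_range_succ, Nat.factorial, mul_pow]
      ring
    rw [h2] at this
    refine this.trans ?_
    have h3 : 0 ≤ |x| ^ 3 := by positivity
    norm_num [Nat.factorial]
    linarith
  · have h1 : ‖exp (x * I)‖ = 1 := norm_exp_ofReal_mul_I x
    have h2 : ‖((x : ℂ) ^ 2 / 2)‖ = |x| ^ 2 / 2 := by simp
    calc ‖exp (x * I) - (1 + x * I - (x : ℂ) ^ 2 / 2)‖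
        ≤ ‖exp (x * I)‖ + (‖(1 : ℂ)‖ + ‖(x * I : ℂ)‖ + ‖((x : ℂ) ^ 2 / 2)‖) :=
          (norm_sub_le _ _).trans (by
            gcongr
            exact (norm_sub_le _ _).trans (by gcongr; exact norm_add_le _ _))
      _ ≤ 4 * |x| ^ 3 := by
        rw [h1, hnx, h2, norm_one]
        have h4 : |x| ≤ |x| ^ 3 := by nlinarith [abs_nonneg x]
        have h5 : |x| ^ 2 ≤ |x| ^ 3 := by nlinarith [abs_nonneg x, sq_nonneg |x|]
        linarith

/-- Poisson approximation of the generating function of a sum of independent Bernoulli variables. -/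
theorem norm_prod_bernoulli_sub_exp_le {s : Multiset ℝ} (hs : ∀ p ∈ s, 0 ≤ p ∧ p ≤ 1) {w : ℂ}
    (hw : ‖w‖ = 1) :
    ‖(s.map fun p : ℝ ↦ 1 + p * (w - 1)).prod - exp ((s.sum : ℝ) * (w - 1))‖ ≤
      12 * (s.map (· ^ 2)).sum := by
  have hre : w.re ≤ 1 := hw ▸ re_le_norm w
  have hprod : exp ((s.sum : ℝ) * (w - 1)) = (s.map fun p : ℝ ↦ exp (p * (w - 1))).prod := by
    rw [show (s.map fun p : ℝ ↦ exp (p * (w - 1))) =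
      (s.map fun p : ℝ ↦ (p * (w - 1) : ℂ)).map exp by simp [Multiset.map_map],
      ← exp_multiset_sum, Multiset.sum_map_mul_right]
    congr 2
    exact map_multiset_sum ofRealHom s
  have hnorm : ‖w - 1‖ ≤ 2 := (norm_sub_le _ _).trans (by rw [hw, norm_one]; norm_num)
  rw [hprod, ← Multiset.sum_map_mul_left]
  refine norm_multiset_prod_sub_prod_le ?_ ?_ ?_
  · intro p hp
    obtain ⟨h0, h1⟩ := hs p hp
    calc ‖1 + p * (w - 1)‖ = ‖((1 - p : ℝ) : ℂ) + (p : ℂ) * w‖ := by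
          congr 1; push_cast; ring
      _ ≤ |1 - p| + |p| * 1 := by
          refine (norm_add_le _ _).trans ?_
          rw [norm_mul, hw, norm_real, norm_real]; rfl
      _ = 1 := by rw [abs_of_nonneg h0, abs_of_nonneg (by linarith)]; ring
  · intro p hp
    obtain ⟨h0, h1⟩ := hs p hp
    rw [norm_exp, Real.exp_le_one_iff, re_ofReal_mul]
    simp only [sub_re, one_re]
    nlinarith
  · intro p hp
    obtain ⟨h0, h1⟩ := hs p hp
    have hle : (p * (w - 1) : ℂ).re ≤ 0 := by
      rw [re_ofReal_mul]
      simp only [sub_re, one_re]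
      nlinarith
    have := norm_exp_sub_one_sub_le hle
    calc ‖1 + p * (w - 1) - exp (p * (w - 1))‖ = ‖exp (p * (w - 1)) - 1 - p * (w - 1)‖ := by
          rw [← norm_neg]; congr 1; ring
      _ ≤ 3 * ‖(p * (w - 1) : ℂ)‖ ^ 2 := this
      _ ≤ 3 * (p * 2) ^ 2 := by
          rw [norm_mul, norm_real, Real.norm_of_nonneg h0]; gcongr
      _ = 12 * p ^ 2 := by ring

/-- The characteristic function of a centred Bernoulli variable of variance `v` is close to that of
the Gaussian law of variance `v`. -/
theorem norm_bernoulli_sub_exp_le {p : ℝ} (h0 : 0 ≤ p) (h1 : p ≤ 1) (θ : ℝ) :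
    ‖(1 + p * (exp (θ * I) - 1)) * exp (-(θ * p) * I) - exp (-θ ^ 2 / 2 * (p - p ^ 2))‖ ≤
      (p - p ^ 2) * (4 * |θ| ^ 3 + θ ^ 4) := by
  set v := p - p ^ 2 with hv
  have hv0 : 0 ≤ v := by nlinarith
  have hv1 : v ≤ 1 := by nlinarith
  have e1 := norm_exp_mul_I_sub_le (-(p * θ))
  have e2 := norm_exp_mul_I_sub_le ((1 - p) * θ)
  set R1 := exp ((-(p * θ) : ℝ) * I) -
    (1 + ((-(p * θ) : ℝ) : ℂ) * I - ((-(p * θ) : ℝ) : ℂ) ^ 2 / 2) with hR1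
  set R2 := exp (((1 - p) * θ : ℝ) * I) -
    (1 + (((1 - p) * θ : ℝ) : ℂ) * I - (((1 - p) * θ : ℝ) : ℂ) ^ 2 / 2) with hR2
  set y : ℂ := ((-(θ ^ 2 / 2 * v) : ℝ) : ℂ) with hy
  have e3 : ‖exp y - 1 - y‖ ≤ 3 * ‖y‖ ^ 2 := norm_exp_sub_one_sub_le (by
    rw [hy, ofReal_re]; have : 0 ≤ θ ^ 2 / 2 * v := by positivity
    linarith)
  have hy' : ‖y‖ = θ ^ 2 / 2 * v := by
    rw [hy, norm_real, norm_neg, Real.norm_of_nonneg (by positivity)]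
  have hexp : exp (-θ ^ 2 / 2 * (p - p ^ 2)) = exp y := by
    rw [hy, hv]; congr 1; push_cast; ring
  -- The centred variable takes the value -p with probability 1 - p and 1 - p with probability p.
  have hsplit : (1 + p * (exp (θ * I) - 1)) * exp (-(θ * p) * I) =
      (1 - p) * exp ((-(p * θ) : ℝ) * I) + p * exp (((1 - p) * θ : ℝ) * I) := by
    have : exp (((1 - p) * θ : ℝ) * I) = exp (θ * I) * exp (-(θ * p) * I) := by
      rw [← exp_add]; congr 1; push_cast; ring
    rw [this, show ((-(p * θ) : ℝ) * I : ℂ) = -(θ * p) * I by push_cast; ring]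
    ring
  -- The linear Taylor terms cancel because the mean is 0, and the quadratic ones add up to -θ²v/2 =
  -- y; only remainders are left.
  have hmain : (1 + p * (exp (θ * I) - 1)) * exp (-(θ * p) * I) -
      exp (-θ ^ 2 / 2 * (p - p ^ 2)) =
      ((1 - p : ℝ) : ℂ) * R1 + (p : ℂ) * R2 - (exp y - 1 - y) := by
    rw [hexp, hsplit, hR1, hR2, hy, hv]
    push_cast
    ring
  rw [hmain]
  have hb1 : ‖R1‖ ≤ 4 * (p ^ 3 * |θ| ^ 3) := by
    refine e1.trans_eq ?_
    rw [abs_neg, abs_mul, abs_of_nonneg h0, mul_pow]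
  have hb2 : ‖R2‖ ≤ 4 * ((1 - p) ^ 3 * |θ| ^ 3) := by
    refine e2.trans_eq ?_
    rw [abs_mul, abs_of_nonneg (by linarith : 0 ≤ 1 - p), mul_pow]
  have ht : 0 ≤ |θ| ^ 3 := by positivity
  calc ‖((1 - p : ℝ) : ℂ) * R1 + (p : ℂ) * R2 - (exp y - 1 - y)‖
      ≤ (1 - p) * ‖R1‖ + p * ‖R2‖ + ‖exp y - 1 - y‖ := by
        refine (norm_sub_le _ _).trans ?_
        gcongr
        refine (norm_add_le _ _).trans ?_
        rw [norm_mul, norm_mul, norm_real, norm_real, Real.norm_of_nonneg h0,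
          Real.norm_of_nonneg (by linarith : 0 ≤ 1 - p)]
    _ ≤ (1 - p) * (4 * (p ^ 3 * |θ| ^ 3)) + p * (4 * ((1 - p) ^ 3 * |θ| ^ 3)) +
        3 * (θ ^ 2 / 2 * v) ^ 2 := by
        have : 0 ≤ 1 - p := by linarith
        rw [hy'] at e3
        gcongr
    _ = v * (4 * (p ^ 2 + (1 - p) ^ 2) * |θ| ^ 3 + 3 / 4 * θ ^ 4 * v) := by rw [hv]; ring
    _ ≤ v * (4 * 1 * |θ| ^ 3 + 1 * θ ^ 4 * 1) := by
        have : p ^ 2 + (1 - p) ^ 2 ≤ 1 := by nlinarith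
        have : (0 : ℝ) ≤ θ ^ 4 := by positivity
        gcongr
        norm_num
    _ = v * (4 * |θ| ^ 3 + θ ^ 4) := by ring

/-- Gaussian approximation of the characteristic function of a centred sum of independent Bernoulli
variables. -/
theorem norm_prod_bernoulli_mul_exp_sub_exp_le {s : Multiset ℝ}
    (hs : ∀ p ∈ s, 0 ≤ p ∧ p ≤ 1) (θ : ℝ) :
    ‖(s.map fun p : ℝ ↦ 1 + p * (exp (θ * I) - 1)).prod * exp (-(θ * (s.sum : ℝ)) * I) -
      exp (-θ ^ 2 / 2 * ((s.sum - (s.map (· ^ 2)).sum : ℝ) : ℂ))‖ ≤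
      (s.sum - (s.map (· ^ 2)).sum) * (4 * |θ| ^ 3 + θ ^ 4) := by
  have hsub : s.sum - (s.map (· ^ 2)).sum = (s.map fun p ↦ p - p ^ 2).sum := by
    rw [Multiset.sum_map_sub, Multiset.map_id']
  have h1 : exp (-(θ * (s.sum : ℝ)) * I) = (s.map fun p : ℝ ↦ exp (-(θ * p) * I)).prod := by
    rw [show (s.map fun p : ℝ ↦ exp (-(θ * p) * I)) =
      (s.map fun p : ℝ ↦ ((-θ * I) * p : ℂ)).map exp by
        simp only [Multiset.map_map, Function.comp_def]
        refine Multiset.map_congr rfl fun p _ ↦ ?_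
        congr 1; ring,
      ← exp_multiset_sum, Multiset.sum_map_mul_left,
      show ((s.sum : ℝ) : ℂ) = (s.map fun p : ℝ ↦ (p : ℂ)).sum from map_multiset_sum ofRealHom s]
    congr 1; ring
  have h2 : exp (-θ ^ 2 / 2 * ((s.sum - (s.map (· ^ 2)).sum : ℝ) : ℂ)) =
      (s.map fun p : ℝ ↦ exp (-θ ^ 2 / 2 * (p - p ^ 2))).prod := by
    rw [show (s.map fun p : ℝ ↦ exp (-θ ^ 2 / 2 * (p - p ^ 2))) =
      (s.map fun p : ℝ ↦ (-θ ^ 2 / 2 * (p - p ^ 2) : ℂ)).map exp by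
        simp [Multiset.map_map],
      ← exp_multiset_sum, Multiset.sum_map_mul_left, hsub]
    congr 2
    have := map_multiset_sum ofRealHom (s.map fun p ↦ p - p ^ 2)
    simpa [Multiset.map_map, Function.comp_def] using this
  rw [h1, h2, hsub, ← Multiset.prod_map_mul, ← Multiset.sum_map_mul_right]
  refine norm_multiset_prod_sub_prod_le ?_ ?_ ?_
  · intro p hp
    obtain ⟨h0, h1⟩ := hs p hp
    have hn : ‖exp (-(θ * p) * I)‖ = 1 := by
      have := norm_exp_ofReal_mul_I (-(θ * p))
      push_cast at this
      exact this
    rw [norm_mul, hn, mul_one]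
    calc ‖1 + p * (exp (θ * I) - 1)‖ = ‖((1 - p : ℝ) : ℂ) + (p : ℂ) * exp (θ * I)‖ := by
          congr 1; push_cast; ring
      _ ≤ |1 - p| + |p| * 1 := by
          refine (norm_add_le _ _).trans ?_
          rw [norm_mul, norm_exp_ofReal_mul_I, norm_real, norm_real]; rfl
      _ = 1 := by rw [abs_of_nonneg h0, abs_of_nonneg (by linarith)]; ring
  · intro p hp
    obtain ⟨h0, h1⟩ := hs p hp
    have : (-θ ^ 2 / 2 * (p - p ^ 2) : ℂ) = ((-θ ^ 2 / 2 * (p - p ^ 2) : ℝ) : ℂ) := by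
      push_cast; ring
    rw [this, norm_exp, Real.exp_le_one_iff, ofReal_re]
    nlinarith [mul_nonneg (sq_nonneg θ) (mul_nonneg h0 (sub_nonneg.2 h1))]
  · intro p hp
    obtain ⟨h0, h1⟩ := hs p hp
    exact norm_bernoulli_sub_exp_le h0 h1 θ

end estimates

/-! ### Moments and the passage to countable families. -/

section family

variable {Ω ι : Type*} [MeasurableSpace Ω] {P : Measure Ω} {η : ι → Ω → ℝ}

theorem StrongRayleighFamily.ae_nonneg (h : StrongRayleighFamily P η) (x : ι) :
    0 ≤ᵐ[P] η x := by
  filter_upwards [h.bernoulli x] with ω hω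
  rcases hω with hω | hω <;> simp [hω]

theorem StrongRayleighFamily.integral_nonneg (h : StrongRayleighFamily P η) (x : ι) :
    0 ≤ ∫ ω, η x ω ∂P :=
  integral_nonneg_of_ae (h.ae_nonneg x)

/-- No summability is needed: where the series diverges, both the real `tsum` and `toReal` of the
extended sum are 0. Hence the counts are measurable for every n, not just for large n. -/
theorem StrongRayleighFamily.aemeasurable_tsum [Countable ι] (h : StrongRayleighFamily P η) :
    AEMeasurable (fun ω ↦ ∑' x, η x ω) P := by
  have h1 : AEMeasurable (fun ω ↦ (∑' x, ENNReal.ofReal (η x ω)).toReal) P :=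
    (AEMeasurable.tsum fun x ↦ (h.aemeasurable x).ennreal_ofReal).ennreal_toReal
  refine h1.congr ?_
  filter_upwards [ae_all_iff.2 h.ae_nonneg] with ω hω
  rw [ENNReal.tsum_toReal_eq fun _ ↦ ENNReal.ofReal_ne_top]
  exact tsum_congr fun x ↦ ENNReal.toReal_ofReal (hω x)

variable [IsProbabilityMeasure P]

theorem StrongRayleighFamily.memLp (h : StrongRayleighFamily P η) (x : ι) : MemLp (η x) 2 P := by
  refine MemLp.of_bound (h.aemeasurable x).aestronglyMeasurable 1 ?_
  filter_upwards [h.bernoulli x] with ω hω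
  rcases hω with hω | hω <;> simp [hω]

theorem StrongRayleighFamily.integrable (h : StrongRayleighFamily P η) (x : ι) :
    Integrable (η x) P :=
  (h.memLp x).integrable one_le_two

theorem StrongRayleighFamily.integral_le_one (h : StrongRayleighFamily P η) (x : ι) :
    ∫ ω, η x ω ∂P ≤ 1 := by
  have : ∫ ω, η x ω ∂P ≤ ∫ _, (1 : ℝ) ∂P := by
    refine integral_mono_ae (h.integrable x) (integrable_const _) ?_
    filter_upwards [h.bernoulli x] with ω hω
    rcases hω with hω | hω <;> simp [hω]
  simpa using this

theorem StrongRayleighFamily.variance_eq (h : StrongRayleighFamily P η) (x : ι) :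
    Var[η x; P] = ∫ ω, η x ω ∂P - (∫ ω, η x ω ∂P) ^ 2 := by
  rw [variance_eq_sub (h.memLp x)]
  congr 1
  refine integral_congr_ae ?_
  filter_upwards [h.bernoulli x] with ω hω
  rcases hω with hω | hω <;> simp [hω]

theorem StrongRayleighFamily.memLp_sum (h : StrongRayleighFamily P η) (F : Finset ι) :
    MemLp (fun ω ↦ ∑ x ∈ F, η x ω) 2 P :=
  memLp_finsetSum F fun x _ ↦ h.memLp x

theorem StrongRayleighFamily.integral_sum (h : StrongRayleighFamily P η) (F : Finset ι) :
    ∫ ω, ∑ x ∈ F, η x ω ∂P = ∑ x ∈ F, ∫ ω, η x ω ∂P :=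
  integral_finsetSum F fun x _ ↦ h.integrable x

theorem StrongRayleighFamily.variance_sum [DecidableEq ι] (h : StrongRayleighFamily P η)
    (F : Finset ι) :
    Var[fun ω ↦ ∑ x ∈ F, η x ω; P] = ∑ x ∈ F, ∫ ω, η x ω ∂P - ∑ x ∈ F, (∫ ω, η x ω ∂P) ^ 2 +
      ∑ p ∈ F.offDiag, cov[η p.1, η p.2; P] := by
  rw [variance_fun_sum' fun x _ ↦ h.memLp x,
    ← Finset.sum_product' F F fun x y ↦ cov[η x, η y; P], ← Finset.diag_union_offDiag,
    Finset.sum_union (Finset.disjoint_diag_offDiag F), Finset.sum_diag, ← Finset.sum_sub_distrib]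
  congr 1
  refine Finset.sum_congr rfl fun x _ ↦ ?_
  rw [covariance_self (h.aemeasurable x), h.variance_eq]

open Complex in
/-- The Bernoulli decomposition of the number of points of a finite strong Rayleigh family, with
its characteristic function, mean and variance. -/
theorem StrongRayleighFamily.exists_bernoulli_charFun (h : StrongRayleighFamily P η)
    (F : Finset ι) :
    ∃ s : Multiset ℝ, (∀ p ∈ s, 0 ≤ p ∧ p ≤ 1) ∧
      (∀ θ : ℝ, ∫ ω, exp (θ * (∑ x ∈ F, η x ω : ℝ) * I) ∂P =
        (s.map fun p : ℝ ↦ 1 + p * (exp (θ * I) - 1)).prod) ∧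
      ∑ x ∈ F, ∫ ω, η x ω ∂P = s.sum ∧
      Var[fun ω ↦ ∑ x ∈ F, η x ω; P] = s.sum - (s.map (· ^ 2)).sum := by
  obtain ⟨s, hs, hφ, hmean, hsq⟩ := h.exists_bernoulli F
  refine ⟨s, hs, fun θ ↦ ?_, by rw [← hmean, h.integral_sum], ?_⟩
  · refine hφ (exp (θ * I)) (fun t ↦ exp (θ * t * I)) fun k ↦ ?_
    rw [← exp_nat_mul]
    congr 1; push_cast; ring
  · rw [variance_eq_sub (h.memLp_sum F), hmean]
    simp only [Pi.pow_apply]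
    rw [hsq]
    ring

theorem StrongRayleighFamily.summable_sq (h : StrongRayleighFamily P η)
    (hsum : Summable fun x ↦ ∫ ω, η x ω ∂P) : Summable fun x ↦ (∫ ω, η x ω ∂P) ^ 2 :=
  hsum.of_nonneg_of_le (fun _ ↦ sq_nonneg _) fun x ↦ by
    have := h.integral_nonneg x
    have := h.integral_le_one x
    nlinarith

/-- The total covariance of a finite subfamily is bounded below by minus its mean. -/
theorem StrongRayleighFamily.neg_sum_integral_le_sum_covariance [DecidableEq ι]
    (h : StrongRayleighFamily P η) (F : Finset ι) :
    ∑ p ∈ F.offDiag, -cov[η p.1, η p.2; P] ≤ ∑ x ∈ F, ∫ ω, η x ω ∂P := by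
  have h1 := h.variance_sum F
  have h2 := variance_nonneg (fun ω ↦ ∑ x ∈ F, η x ω) P
  have h3 : 0 ≤ ∑ x ∈ F, (∫ ω, η x ω ∂P) ^ 2 := Finset.sum_nonneg fun _ _ ↦ sq_nonneg _
  rw [Finset.sum_neg_distrib]
  linarith

/-- All these covariances have one sign, and nonnegativity of the variance bounds their finite sums
by the total mean. -/
theorem StrongRayleighFamily.summable_covariance (h : StrongRayleighFamily P η)
    (hsum : Summable fun x ↦ ∫ ω, η x ω ∂P) :
    Summable fun p : {p : ι × ι // p.1 ≠ p.2} ↦ cov[η p.1.1, η p.1.2; P] := by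
  classical
  rw [← summable_neg_iff]
  refine summable_of_sum_le (c := ∑' x, ∫ ω, η x ω ∂P)
    (fun p ↦ neg_nonneg.2 (h.covariance_nonpos p.2)) fun u ↦ ?_
  set F : Finset ι := u.image (fun p ↦ p.1.1) ∪ u.image (fun p ↦ p.1.2) with hF
  calc ∑ p ∈ u, -cov[η p.1.1, η p.1.2; P]
      = ∑ p ∈ u.map (Function.Embedding.subtype _), -cov[η p.1, η p.2; P] := by
        rw [Finset.sum_map]; rfl
    _ ≤ ∑ p ∈ F.offDiag, -cov[η p.1, η p.2; P] := by
        refine Finset.sum_le_sum_of_subset_of_nonneg ?_ fun p hp _ ↦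
          neg_nonneg.2 (h.covariance_nonpos (Finset.mem_offDiag.1 hp).2.2)
        intro p hp
        obtain ⟨q, hq, rfl⟩ := Finset.mem_map.1 hp
        refine Finset.mem_offDiag.2 ⟨?_, ?_, q.2⟩
        · exact Finset.mem_union_left _ (Finset.mem_image_of_mem (fun p ↦ p.1.1) hq)
        · exact Finset.mem_union_right _ (Finset.mem_image_of_mem (fun p ↦ p.1.2) hq)
    _ ≤ ∑ x ∈ F, ∫ ω, η x ω ∂P := h.neg_sum_integral_le_sum_covariance F
    _ ≤ ∑' x, ∫ ω, η x ω ∂P := hsum.sum_le_tsum F fun x _ ↦ h.integral_nonneg x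

theorem StrongRayleighFamily.neg_sum_covariance_le_tsum [DecidableEq ι]
    (h : StrongRayleighFamily P η) (hsum : Summable fun x ↦ ∫ ω, η x ω ∂P) (F : Finset ι) :
    -∑ p ∈ F.offDiag, cov[η p.1, η p.2; P] ≤
      -∑' p : {p : ι × ι // p.1 ≠ p.2}, cov[η p.1.1, η p.1.2; P] := by
  have h1 : ∑ p ∈ F.offDiag, -cov[η p.1, η p.2; P] =
      ∑ p ∈ F.offDiag.subtype (fun p ↦ p.1 ≠ p.2), -cov[η p.1.1, η p.1.2; P] := by
    refine (Finset.sum_subtype_of_mem (fun p : ι × ι ↦ -cov[η p.1, η p.2; P]) ?_).symm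
    intro p hp
    exact (Finset.mem_offDiag.1 hp).2.2
  rw [← Finset.sum_neg_distrib, h1, ← tsum_neg]
  exact (h.summable_covariance hsum).neg.sum_le_tsum _
    fun p _ ↦ neg_nonneg.2 (h.covariance_nonpos p.2)

/-- The second moment is Σp + (Σp)² - Σp², so a bound on the mean controls it uniformly in F. -/
theorem StrongRayleighFamily.integral_sum_sq_le (h : StrongRayleighFamily P η)
    (hsum : Summable fun x ↦ ∫ ω, η x ω ∂P) (F : Finset ι) :
    ∫ ω, (∑ x ∈ F, η x ω) ^ 2 ∂P ≤
      ∑' x, ∫ ω, η x ω ∂P + (∑' x, ∫ ω, η x ω ∂P) ^ 2 := by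
  obtain ⟨s, hs, -, hmean, hsq⟩ := h.exists_bernoulli F
  rw [h.integral_sum] at hmean
  have h1 : s.sum ≤ ∑' x, ∫ ω, η x ω ∂P := by
    rw [← hmean]
    exact hsum.sum_le_tsum F fun x _ ↦ h.integral_nonneg x
  have h0 : 0 ≤ s.sum := Multiset.sum_nonneg fun p hp ↦ (hs p hp).1
  have h2 : 0 ≤ (s.map (· ^ 2)).sum := Multiset.sum_nonneg fun p hp ↦ by
    obtain ⟨q, -, rfl⟩ := Multiset.mem_map.1 hp
    positivity
  rw [hsq]
  nlinarith

variable [Countable ι]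

theorem StrongRayleighFamily.ae_hasSum (h : StrongRayleighFamily P η)
    (hsum : Summable fun x ↦ ∫ ω, η x ω ∂P) :
    ∀ᵐ ω ∂P, HasSum (fun x ↦ η x ω) (∑' x, η x ω) := by
  have h1 : ∫⁻ ω, ∑' x, ENNReal.ofReal (η x ω) ∂P ≠ ⊤ := by
    rw [lintegral_tsum fun x ↦ (h.aemeasurable x).ennreal_ofReal]
    have : ∀ x, ∫⁻ ω, ENNReal.ofReal (η x ω) ∂P = ENNReal.ofReal (∫ ω, η x ω ∂P) := fun x ↦
      (ofReal_integral_eq_lintegral_ofReal (h.integrable x) (h.ae_nonneg x)).symm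
    simp only [this]
    exact hsum.tsum_ofReal_ne_top
  have h2 := ae_lt_top' (AEMeasurable.tsum fun x ↦ (h.aemeasurable x).ennreal_ofReal) h1
  filter_upwards [h2, ae_all_iff.2 h.ae_nonneg] with ω hω h0
  refine Summable.hasSum ?_
  have := ENNReal.summable_toReal hω.ne
  simpa only [ENNReal.toReal_ofReal (h0 _)] using this

/-- Fatou's lemma along finite subsets, with the uniform second-moment bound. -/
theorem StrongRayleighFamily.memLp_tsum (h : StrongRayleighFamily P η)
    (hsum : Summable fun x ↦ ∫ ω, η x ω ∂P) : MemLp (fun ω ↦ ∑' x, η x ω) 2 P := by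
  rw [memLp_two_iff_integrable_sq h.aemeasurable_tsum.aestronglyMeasurable]
  refine ⟨(h.aemeasurable_tsum.pow_const 2).aestronglyMeasurable, ?_⟩
  have hlim : ∫⁻ ω, ‖(∑' x, η x ω) ^ 2‖ₑ ∂P =
      ∫⁻ ω, liminf (fun F : Finset ι ↦ ‖(∑ x ∈ F, η x ω) ^ 2‖ₑ) atTop ∂P := by
    refine lintegral_congr_ae ?_
    filter_upwards [h.ae_hasSum hsum] with ω hω
    exact ((Tendsto.pow hω 2).enorm.liminf_eq).symm
  rw [HasFiniteIntegral, hlim]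
  refine (lintegral_liminf_le' fun F ↦
    ((h.memLp_sum F).aemeasurable.pow_const 2).enorm).trans_lt ?_
  refine lt_of_le_of_lt (b := ENNReal.ofReal
    (∑' x, ∫ ω, η x ω ∂P + (∑' x, ∫ ω, η x ω ∂P) ^ 2)) ?_ ENNReal.ofReal_lt_top
  refine (liminf_le_liminf (v := fun _ ↦ ENNReal.ofReal
    (∑' x, ∫ ω, η x ω ∂P + (∑' x, ∫ ω, η x ω ∂P) ^ 2)) (Eventually.of_forall fun F ↦ ?_)).trans
    (by simp)
  have h1 : ∀ ω, ‖(∑ x ∈ F, η x ω) ^ 2‖ₑ = ENNReal.ofReal ((∑ x ∈ F, η x ω) ^ 2) := fun ω ↦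
    Real.enorm_of_nonneg (sq_nonneg _)
  simp only [h1]
  rw [← ofReal_integral_eq_lintegral_ofReal (h.memLp_sum F).integrable_sq
    (Eventually.of_forall fun ω ↦ sq_nonneg _)]
  exact ENNReal.ofReal_le_ofReal (h.integral_sum_sq_le hsum F)

theorem StrongRayleighFamily.integral_tsum (h : StrongRayleighFamily P η)
    (hsum : Summable fun x ↦ ∫ ω, η x ω ∂P) :
    ∫ ω, ∑' x, η x ω ∂P = ∑' x, ∫ ω, η x ω ∂P := by
  refine (integral_tsum_of_summable_integral_norm h.integrable (hsum.congr fun x ↦ ?_)).symm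
  refine integral_congr_ae ?_
  filter_upwards [h.ae_nonneg x] with ω hω
  exact (Real.norm_of_nonneg hω).symm

/-- The terms are nonnegative, so the squared total count dominates the squared partial counts. -/
theorem StrongRayleighFamily.tendsto_variance_sum (h : StrongRayleighFamily P η)
    (hsum : Summable fun x ↦ ∫ ω, η x ω ∂P) :
    Tendsto (fun F : Finset ι ↦ Var[fun ω ↦ ∑ x ∈ F, η x ω; P]) atTop
      (𝓝 Var[fun ω ↦ ∑' x, η x ω; P]) := by
  have hL := h.memLp_tsum hsum
  simp only [variance_eq_sub (h.memLp_sum _), variance_eq_sub hL, h.integral_sum,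
    h.integral_tsum hsum, Pi.pow_apply]
  refine Tendsto.sub ?_ (hsum.hasSum.pow 2)
  refine tendsto_integral_filter_of_dominated_convergence (fun ω ↦ (∑' x, η x ω) ^ 2)
    (Eventually.of_forall fun F ↦ ((h.memLp_sum F).aemeasurable.pow_const 2).aestronglyMeasurable)
    (Eventually.of_forall fun F ↦ ?_) hL.integrable_sq ?_
  · filter_upwards [h.ae_hasSum hsum, ae_all_iff.2 h.ae_nonneg] with ω hω h0
    rw [Real.norm_of_nonneg (sq_nonneg _)]
    exact pow_le_pow_left₀ (Finset.sum_nonneg fun x _ ↦ h0 x)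
      (sum_le_hasSum F (fun x _ ↦ h0 x) hω) 2
  · filter_upwards [h.ae_hasSum hsum] with ω hω
    exact Tendsto.pow hω 2

open Complex in
theorem StrongRayleighFamily.tendsto_integral_exp (h : StrongRayleighFamily P η)
    (hsum : Summable fun x ↦ ∫ ω, η x ω ∂P) {θ : Finset ι → ℝ} {θ₀ : ℝ}
    (hθ : Tendsto θ atTop (𝓝 θ₀)) :
    Tendsto (fun F : Finset ι ↦ ∫ ω, exp (θ F * (∑ x ∈ F, η x ω : ℝ) * I) ∂P) atTop
      (𝓝 (∫ ω, exp (θ₀ * (∑' x, η x ω : ℝ) * I) ∂P)) := by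
  refine tendsto_integral_filter_of_norm_le_const (Eventually.of_forall fun F ↦ ?_)
    ⟨1, Eventually.of_forall fun F ↦ Eventually.of_forall fun ω ↦ ?_⟩ ?_
  · have := (h.memLp_sum F).aemeasurable
    have h2 : Measurable fun t : ℝ ↦ exp (θ F * t * I) := by fun_prop
    exact (h2.comp_aemeasurable this).aestronglyMeasurable
  · rw [← ofReal_mul, norm_exp_ofReal_mul_I]
  · filter_upwards [h.ae_hasSum hsum] with ω hω
    have h1 : Tendsto (fun F : Finset ι ↦ θ F * ∑ x ∈ F, η x ω) atTop
      (𝓝 (θ₀ * ∑' x, η x ω)) := hθ.mul hω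
    have h2 : Continuous fun t : ℝ ↦ exp (t * I) := by fun_prop
    have := (h2.tendsto _).comp h1
    simpa [Function.comp_def] using this

open Complex in
/-- Poisson approximation for the number of points of a strong Rayleigh family. -/
theorem StrongRayleighFamily.norm_integral_exp_sub_le (h : StrongRayleighFamily P η)
    (hsum : Summable fun x ↦ ∫ ω, η x ω ∂P) (θ : ℝ) :
    ‖∫ ω, exp (θ * (∑' x, η x ω : ℝ) * I) ∂P -
        exp ((∑' x, ∫ ω, η x ω ∂P : ℝ) * (exp (θ * I) - 1))‖ ≤
      12 * (∑' x, (∫ ω, η x ω ∂P) ^ 2 -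
        ∑' p : {p : ι × ι // p.1 ≠ p.2}, cov[η p.1.1, η p.1.2; P]) := by
  classical
  have h1 : Tendsto (fun F : Finset ι ↦ ∑ x ∈ F, ∫ ω, η x ω ∂P) atTop
    (𝓝 (∑' x, ∫ ω, η x ω ∂P)) := hsum.hasSum
  have h2 : Continuous fun t : ℝ ↦ exp (t * (exp (θ * I) - 1)) := by fun_prop
  refine le_of_tendsto ((h.tendsto_integral_exp hsum tendsto_const_nhds).sub
    ((h2.tendsto _).comp h1)).norm (Eventually.of_forall fun F ↦ ?_)
  obtain ⟨s, hs, hφ, hmean, hvar⟩ := h.exists_bernoulli_charFun F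
  simp only [Function.comp_apply]
  rw [hφ, hmean]
  refine (norm_prod_bernoulli_sub_exp_le hs (norm_exp_ofReal_mul_I θ)).trans ?_
  -- Equating the two formulas for the variance gives Σp² = Σ(Eη)² - ΣCov over F; both parts are at
  -- most their totals.
  have h3 := h.variance_sum F
  rw [hvar, hmean] at h3
  have h4 := (h.summable_sq hsum).sum_le_tsum F fun x _ ↦ sq_nonneg _
  have h5 := h.neg_sum_covariance_le_tsum hsum F
  linarith

open Complex in
/-- Gaussian approximation for the standardized number of points of a strong Rayleigh family. -/
theorem StrongRayleighFamily.norm_integral_exp_standardized_sub_le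
    (h : StrongRayleighFamily P η) (hsum : Summable fun x ↦ ∫ ω, η x ω ∂P)
    (hV : 0 < Var[fun ω ↦ ∑' x, η x ω; P]) (u : ℝ) :
    ‖∫ ω, exp (u * (((∑' x, η x ω) - ∫ ω', ∑' x, η x ω' ∂P) /
          √(Var[fun ω' ↦ ∑' x, η x ω'; P]) : ℝ) * I) ∂P - exp (-u ^ 2 / 2)‖ ≤
      4 * |u| ^ 3 / √(Var[fun ω' ↦ ∑' x, η x ω'; P]) +
        u ^ 4 / Var[fun ω' ↦ ∑' x, η x ω'; P] := by
  set V := Var[fun ω ↦ ∑' x, η x ω; P] with hVdef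
  set M := ∑' x, ∫ ω, η x ω ∂P with hM
  rw [h.integral_tsum hsum, ← hM]
  have hσ : 0 < √V := Real.sqrt_pos.2 hV
  have hv := h.tendsto_variance_sum hsum
  rw [← hVdef] at hv
  have hm : Tendsto (fun F : Finset ι ↦ ∑ x ∈ F, ∫ ω, η x ω ∂P) atTop (𝓝 M) := hsum.hasSum
  -- Scaling each finite count by its own standard deviation makes the Gaussian term exactly
  -- e^{-u²/2} for every F of positive variance.
  have hθ : Tendsto (fun F : Finset ι ↦ u / √Var[fun ω ↦ ∑ x ∈ F, η x ω; P]) atTop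
      (𝓝 (u / √V)) :=
    tendsto_const_nhds.div ((Real.continuous_sqrt.tendsto V).comp hv) hσ.ne'
  have hE := h.tendsto_integral_exp hsum hθ
  have hcont : Continuous fun t : ℝ ↦ exp (-t * I) := by fun_prop
  have hlim : Tendsto (fun F : Finset ι ↦
      ‖(∫ ω, exp ((u / √Var[fun ω ↦ ∑ x ∈ F, η x ω; P] : ℝ) * (∑ x ∈ F, η x ω : ℝ) * I) ∂P) *
        exp (-((u / √Var[fun ω ↦ ∑ x ∈ F, η x ω; P]) * ∑ x ∈ F, ∫ ω, η x ω ∂P : ℝ) * I) -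
        exp (-u ^ 2 / 2)‖) atTop
      (𝓝 ‖(∫ ω, exp ((u / √V : ℝ) * (∑' x, η x ω : ℝ) * I) ∂P) *
        exp (-(u / √V * M : ℝ) * I) - exp (-u ^ 2 / 2)‖) :=
    ((hE.mul ((hcont.tendsto _).comp (hθ.mul hm))).sub tendsto_const_nhds).norm
  have hEq : ∫ ω, exp (u * (((∑' x, η x ω) - M) / √V : ℝ) * I) ∂P =
      (∫ ω, exp ((u / √V : ℝ) * (∑' x, η x ω : ℝ) * I) ∂P) *
        exp (-(u / √V * M : ℝ) * I) := by
    rw [← integral_mul_const]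
    refine integral_congr_ae (Eventually.of_forall fun ω ↦ ?_)
    simp only
    rw [← exp_add]
    congr 1
    push_cast
    ring
  rw [hEq]
  have hbound : Tendsto (fun F : Finset ι ↦
      4 * |u| ^ 3 / √Var[fun ω ↦ ∑ x ∈ F, η x ω; P] + u ^ 4 / Var[fun ω ↦ ∑ x ∈ F, η x ω; P])
      atTop (𝓝 (4 * |u| ^ 3 / √V + u ^ 4 / V)) :=
    (tendsto_const_nhds.div ((Real.continuous_sqrt.tendsto V).comp hv) hσ.ne').add
      (tendsto_const_nhds.div hv hV.ne')
  refine le_of_tendsto_of_tendsto hlim hbound ?_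
  filter_upwards [hv.eventually (lt_mem_nhds hV)] with F hF
  obtain ⟨s, hs, hφ, hmean, hvar⟩ := h.exists_bernoulli_charFun F
  set v := Var[fun ω ↦ ∑ x ∈ F, η x ω; P] with hvdef
  have hσF : 0 < √v := Real.sqrt_pos.2 hF
  have hsq : √v ^ 2 = v := Real.sq_sqrt hF.le
  have key := norm_prod_bernoulli_mul_exp_sub_exp_le hs (u / √v)
  rw [← hvar] at key
  rw [hφ, hmean]
  have e1 : exp (-((u / √v : ℝ) : ℂ) ^ 2 / 2 * (v : ℂ)) = exp (-u ^ 2 / 2) := by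
    congr 1
    have : -(u / √v) ^ 2 / 2 * v = -u ^ 2 / 2 := by
      rw [div_pow, hsq]; field_simp
    exact_mod_cast congrArg (fun t : ℝ ↦ (t : ℂ)) this
  have e2 : v * (4 * |u / √v| ^ 3 + (u / √v) ^ 4) = 4 * |u| ^ 3 / √v + u ^ 4 / v := by
    have h4 : √v ^ 4 = v ^ 2 := by rw [show √v ^ 4 = (√v ^ 2) ^ 2 by ring, hsq]
    have h3 : √v ^ 3 = √v * v := by rw [pow_succ, hsq]; ring
    rw [abs_div, abs_of_pos hσF, div_pow, div_pow, h4, h3]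
    field_simp
  rw [e1, e2] at key
  rw [ofReal_mul]
  exact key

end family

/-! ### The limit theorems, by convergence of characteristic functions. -/

theorem proposition2p2 {Ω ι : ℕ → Type*} [∀ n, MeasurableSpace (Ω n)] [∀ n, Countable (ι n)]
    (P : ∀ n, Measure (Ω n)) [∀ n, IsProbabilityMeasure (P n)]
    (η : ∀ n, ι n → Ω n → ℝ) (hη : ∀ n, StrongRayleighFamily (P n) (η n))
    -- the expected total count is finite for all large `n` (automatic if the rows are finite)
    (hsum : ∀ᶠ n in atTop, Summable fun x ↦ ∫ ω, η n x ω ∂(P n)) :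
    (∀ lam : ℝ≥0,
      Tendsto (fun n ↦ ∑' x, ∫ ω, η n x ω ∂(P n)) atTop (𝓝 (lam : ℝ)) →
      Tendsto (fun n ↦ ∑' x, (∫ ω, η n x ω ∂(P n)) ^ 2) atTop (𝓝 0) →
      Tendsto (fun n ↦ ∑' p : {p : ι n × ι n // p.1 ≠ p.2},
        cov[η n p.1.1, η n p.1.2; P n]) atTop (𝓝 0) →
      TendstoInDistribution (fun n ω ↦ ∑' x, η n x ω) atTop (fun k : ℕ ↦ (k : ℝ)) P
        (poissonMeasure lam)) ∧
    (Tendsto (fun n ↦ Var[fun ω ↦ ∑' x, η n x ω; P n]) atTop atTop →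
      TendstoInDistribution
        (fun n ω ↦ ((∑' x, η n x ω) - ∫ ω', ∑' x, η n x ω' ∂(P n)) /
          √(Var[fun ω' ↦ ∑' x, η n x ω'; P n]))
        atTop id P (gaussianReal 0 1)) := by
  refine ⟨fun lam hlam hsq hcov ↦ ⟨fun n ↦ (hη n).aemeasurable_tsum, .of_discrete, ?_⟩,
    fun hvar ↦ ⟨fun n ↦ ((hη n).aemeasurable_tsum.sub_const _).div_const _, aemeasurable_id, ?_⟩⟩
  · refine ProbabilityMeasure.tendsto_iff_tendsto_charFun.2 fun t ↦ ?_
    simp only [ProbabilityMeasure.coe_mk, charFun_map_cast_poissonMeasure]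
    have hcont : Continuous fun m : ℝ ↦ Complex.exp (m * (Complex.exp (t * Complex.I) - 1)) := by
      fun_prop
    have h1 := (hcont.tendsto _).comp hlam
    have h2 := ((hsq.sub hcov).const_mul 12)
    rw [sub_zero, mul_zero] at h2
    refine tendsto_of_tendsto_of_dist h1 (squeeze_zero' (Eventually.of_forall fun n ↦ dist_nonneg)
      ?_ h2)
    filter_upwards [hsum] with n hn
    rw [dist_comm, dist_eq_norm, charFun_apply_real,
      integral_map (hη n).aemeasurable_tsum (by fun_prop)]
    exact (hη n).norm_integral_exp_sub_le hn t
  · refine ProbabilityMeasure.tendsto_iff_tendsto_charFun.2 fun t ↦ ?_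
    simp only [ProbabilityMeasure.coe_mk, Measure.map_id, charFun_gaussianReal]
    have hsqrt := Real.tendsto_sqrt_atTop.comp hvar
    have h2 : Tendsto (fun n ↦ 4 * |t| ^ 3 / √(Var[fun ω' ↦ ∑' x, η n x ω'; P n]) +
        t ^ 4 / Var[fun ω' ↦ ∑' x, η n x ω'; P n]) atTop (𝓝 0) := by
      simpa using (hsqrt.const_div_atTop (4 * |t| ^ 3)).add (hvar.const_div_atTop (t ^ 4))
    refine tendsto_of_tendsto_of_dist (tendsto_const_nhds (x := Complex.exp (-t ^ 2 / 2)))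
      (squeeze_zero' (Eventually.of_forall fun n ↦ dist_nonneg) ?_ h2) |>.trans_eq ?_
    · filter_upwards [hsum, hvar.eventually_gt_atTop 0] with n hn hV
      rw [dist_comm, dist_eq_norm, charFun_apply_real,
        integral_map (((hη n).aemeasurable_tsum.sub_const _).div_const _) (by fun_prop)]
      exact (hη n).norm_integral_exp_standardized_sub_le hn hV t
    · congr 2
      simp [neg_div]
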